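/- Let $(R,\mathfrak m)$ be a Noetherian local ring with infinite residue field $k$, and let $I$ be an $R$-ideal. Let $\mathcal F=\bigoplus_{j\ge 0} I^j/\mathfrak m I^j$ be its special fiber ring. Let $\ell=\dim\mathcal F$ be the analytic spread of $I$, and let $r$ be the reduction number of $I$, that is, the least integer $s\ge 0$ such that $I^{s+1}=JI^s$ for some minimal reduction $J$ of $I$. Assume that the minimal number of generators of $I$ is $\ell+1$. Let $a_1,\dots,a_\ell$ be general elements in $I$ and let $\mathfrak a_i=(a_1,\dots,a_i)$ for $0\le i\le \ell$. Assume that \[ (\mathfrak a_i I^{r-1} : a_{i+1})\cap I^r=\mathfrak a_i I^{r-1}\qquad\text{whenever } 0\le i\le \ell-1 . \] Then $\mathcal F$ is Cohen--Macaulay, and hence a hypersurface ring: if $x_1,\dots,x_{\ell+1}$ generate $I$, then $T_j\mapsto x_j+\mathfrak m I$ induces an isomorphism of $k$-algebras $k[T_1,\dots,T_{\ell+1}]/(g)\cong\mathcal F$ for some nonzero homogeneous polynomial $g$. Here ``general'' means the following: there is a nonempty Zariski-open subset $U$ of the affine space $(I/\mathfrak m I)^\ell\cong k^{\ell(\ell+1)}$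 such that the assertion holds for all $a_1,\dots,a_\ell\in I$ whose tuple of residue classes lies in $U$. -/

import Mathlib

open IsLocalRing

universe u

section CohenMacaulay

/-- The depth of a local ring `A`: the supremum of the lengths of the `A`-regular sequences
contained in the maximal ideal. -/
noncomputable def localDepth (A : Type u) [CommRing A] [IsLocalRing A] : ℕ∞ :=
  ⨆ rs : {rs : List A //
    RingTheory.Sequence.IsRegular A rs ∧ ∀ x ∈ rs, x ∈ maximalIdeal A}, (rs.1.length : ℕ∞)

/-- A Cohen-Macaulay local ring: a Noetherian local ring whose depth is its Krull dimension. -/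
def IsCohenMacaulayLocal (A : Type u) [CommRing A] [IsLocalRing A] : Prop :=
  IsNoetherianRing A ∧ (localDepth A : WithBot ℕ∞) = ringKrullDim A

/-- A Cohen-Macaulay ring: a Noetherian ring all of whose localizations at primes are
Cohen-Macaulay local rings. -/
def IsCohenMacaulay (A : Type u) [CommRing A] : Prop :=
  IsNoetherianRing A ∧
    ∀ (p : Ideal A) [p.IsPrime], IsCohenMacaulayLocal (Localization.AtPrime p)

end CohenMacaulay

section Reductions

/-- `J` is a reduction of `I`: `J ⊆ I` and `I ^ (s + 1) = J I ^ s` for some `s`. -/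
def IsReductionOf {R : Type u} [CommRing R] (J I : Ideal R) : Prop :=
  J ≤ I ∧ ∃ s : ℕ, I ^ (s + 1) = J * I ^ s

/-- `J` is a minimal reduction of `I`: it is minimal with respect to containment among the
reductions of `I`. -/
def IsMinimalReductionOf {R : Type u} [CommRing R] (J I : Ideal R) : Prop :=
  Minimal (fun J' : Ideal R => IsReductionOf J' I) J

/-- The reduction number `r_J(I)` of `I` with respect to a reduction `J`: the least `s` with
`I ^ (s + 1) = J I ^ s`. -/
noncomputable def reductionNumberWrt {R : Type u} [CommRing R] (J I : Ideal R) : ℕ :=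
  sInf {s : ℕ | I ^ (s + 1) = J * I ^ s}

/-- The reduction number of `I`: the least `r_J(I)`, where `J` ranges over all minimal
reductions of `I`. -/
noncomputable def reductionNumber {R : Type u} [CommRing R] (I : Ideal R) : ℕ :=
  sInf {s : ℕ | ∃ J : Ideal R, IsMinimalReductionOf J I ∧ s = reductionNumberWrt J I}

end Reductions

section FiberRing

variable {R : Type u} [CommRing R] [IsLocalRing R]

/-- The special fiber ring `F = 𝓡 / 𝔪𝓡` of `I`, where `𝓡 = ⨁ I ^ j`, realized as the subring
`∑ I ^ j t ^ j` of `R[t]`, is the Rees algebra of `I`. -/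
abbrev SpecialFiberRing (I : Ideal R) : Type u :=
  reesAlgebra I ⧸ (maximalIdeal R).map (algebraMap R (reesAlgebra I))

noncomputable instance SpecialFiberRing.residueAlgebra (I : Ideal R) :
    Algebra (ResidueField R) (SpecialFiberRing I) :=
  inferInstanceAs (Algebra (R ⧸ maximalIdeal R)
    (reesAlgebra I ⧸ (maximalIdeal R).map (algebraMap R (reesAlgebra I))))

/-- The analytic spread of `I`: the Krull dimension of its special fiber ring. -/
noncomputable def analyticSpread (I : Ideal R) : WithBot ℕ∞ :=
  ringKrullDim (SpecialFiberRing I)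

/-- The degree one element of the special fiber ring of `I` given by `x ∈ I`, that is, the class
of `x t`. -/
noncomputable def SpecialFiberRing.ofIdeal (I : Ideal R) (x : I) : SpecialFiberRing I :=
  Ideal.Quotient.mk _ ⟨Polynomial.monomial 1 (x : R),
    reesAlgebra.monomial_mem.2 (by rw [pow_one]; exact x.2)⟩

/-- Let `x₁, …, xₙ ∈ I` and let `k` be the residue field. The special fiber ring `F` is a
hypersurface ring presented by `x` if, for a nonzero homogeneous polynomial `g`, there is an
isomorphism of `k`-algebras from `k[T₁, …, Tₙ] / (g)` to `F` that sends `Tⱼ` to the degree one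
element of `F` given by `xⱼ`. -/
def IsFiberHypersurface (I : Ideal R) {n : ℕ} (x : Fin n → I) : Prop :=
  ∃ (d : ℕ) (g : MvPolynomial (Fin n) (ResidueField R)), g ≠ 0 ∧ g.IsHomogeneous d ∧
    ∃ e : (MvPolynomial (Fin n) (ResidueField R) ⧸ Ideal.span {g}) ≃ₐ[ResidueField R]
        SpecialFiberRing I,
      ∀ j, e (Ideal.Quotient.mk _ (MvPolynomial.X j)) = SpecialFiberRing.ofIdeal I (x j)

/-- The property `P` holds for general elements `a₁, …, a_ℓ` of `I`: for generators `f₁, …, fₙ`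
of `I` and `aᵢ = ∑ⱼ cᵢⱼ fⱼ`, it holds as soon as the matrix of the residue classes of the `cᵢⱼ`
lies in a suitable nonempty Zariski-open subset of the affine space of `ℓ × n` matrices over the
residue field. Here that subset is given as the nonvanishing locus of a nonzero polynomial; over
an infinite field every nonempty Zariski-open subset contains a nonempty one of this form. -/
def HoldsForGeneral (I : Ideal R) (ℓ : ℕ) (P : (Fin ℓ → R) → Prop) : Prop :=
  ∀ (n : ℕ) (f : Fin n → R), Ideal.span (Set.range f) = I →
    ∃ p : MvPolynomial (Fin ℓ × Fin n) (ResidueField R), p ≠ 0 ∧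
      ∀ c : Fin ℓ × Fin n → R,
        MvPolynomial.eval (fun ij => residue R (c ij)) p ≠ 0 →
          P (fun i => ∑ j, c (i, j) * f j)

end FiberRing

/-! ### Regular sequences as long as the dimension, and polynomial rings over a field. -/

section RegularSequences

open RingTheory.Sequence Polynomial

/-! Write `r = s + 1`, `J = (a₁, …, a_ℓ)` and `I = (y, a₁, …, a_ℓ)`. Call a form over `R` in `X₀, …,
X_ℓ` a relation if it vanishes at `(y, a)`. Elements of `𝔪 I ^ d` are values of forms of degree `d`
with coefficients in `𝔪`, so the kernel of `k[X₀, …, X_ℓ] → F` consists of sums of relations reduced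
modulo `𝔪`. The point is that this kernel is generated by one form that is monic in `X₀`
(`fiberEval_eq_zero_iff`).

Because `I ^ (r + 1) = J I ^ r`, the colon conditions pass to all higher powers of `I`
(`colon_condition_of_le`). They make the `aᵢ` behave like a regular sequence: a relation `∑ Xᵢ zᵢ`
over `i ≥ 1` with the `zᵢ` of degree at least `r` can be rewritten as `∑ Xᵢ wᵢ` with every `wᵢ` a
relation (`exists_relations_of_sum_eq_zero`). As `y ^ (r + 1) ∈ J I ^ r`, there is a relation `g =
X₀ ^ (r + 1) - ∑ Xᵢ vᵢ`. Subtracting a multiple of `g` from a relation of degree greater than `r`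
removes its pure power of `X₀`, and rewriting then lowers the degree (`map_residue_mem_span`).

It remains to see that a relation `h` of degree `r` vanishes modulo `𝔪` (`map_residue_eq_zero`). Its
coefficient at `X₀ ^ r` lies in `𝔪`, since otherwise `I ^ r = J I ^ (r - 1)`. Rewriting `X₀ h` then
gives `X₀ h = ∑ Xᵢ wᵢ` modulo `𝔪` with relations `wᵢ` of degree `r`; unless `h` vanishes, some `wᵢ`
has larger `X₀`-degree than `h`, and this cannot go on. Hence `F` is a polynomial ring modulo `g`,
finite and free over `k[X₁, …, X_ℓ]`, and therefore Cohen-Macaulay.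

For general `a` the equation `I ^ (r + 1) = J I ^ r` holds because by Nakayama it is a spanning
condition in `I ^ (r + 1) / 𝔪 I ^ (r + 1)`, which is open, and some `ℓ` elements satisfy it
(`exists_span_pow_eq_reductionNumber`, where `k` infinite is used). Conversely, a reduction with `ℓ`
generators is minimal, so `I ^ r ≠ J I ^ (r - 1)` (`reductionNumber_le`); its generators are
independent modulo `𝔪 I`, so one element `y` completes them to generators of `I`. -/

/-- There is a weakly regular sequence in the maximal ideal at least as long as the dimension. -/
def HasLongRegularSequence (A : Type*) [CommRing A] [IsLocalRing A] : Prop :=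
  ∃ rs : List A, (∀ x ∈ rs, x ∈ maximalIdeal A) ∧ IsWeaklyRegular A rs ∧
    ringKrullDim A ≤ rs.length

/-- Flat local homomorphisms not raising the dimension preserve long regular sequences. -/
lemma HasLongRegularSequence.of_flat {A B : Type*} [CommRing A] [CommRing B] [IsLocalRing A]
    [IsLocalRing B] [Algebra A B] [Module.Flat A B] [IsLocalHom (algebraMap A B)]
    (hA : HasLongRegularSequence A) (hdim : ringKrullDim B ≤ ringKrullDim A) :
    HasLongRegularSequence B := by
  obtain ⟨rs, hm, hw, hd⟩ := hA
  refine ⟨rs.map (algebraMap A B), ?_, hw.of_flat, ?_⟩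
  · intro x hx
    obtain ⟨y, hy, rfl⟩ := List.mem_map.1 hx
    exact map_nonunit _ _ (hm y hy)
  · rw [List.length_map]; exact hdim.trans hd

/-- A regular sequence lowers the dimension by its length, so depth never exceeds dimension; the
given sequence supplies the other inequality. -/
lemma HasLongRegularSequence.isCohenMacaulayLocal {A : Type u} [CommRing A] [IsLocalRing A]
    [IsNoetherianRing A] (hA : HasLongRegularSequence A) : IsCohenMacaulayLocal A := by
  refine ⟨inferInstance, le_antisymm ?_ ?_⟩
  · obtain ⟨d, hd⟩ : ∃ d : ℕ∞, ringKrullDim A = d :=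
      ⟨_, (maximalIdeal_height_eq_ringKrullDim (R := A)).symm⟩
    rw [hd, WithBot.coe_le_coe]
    refine iSup_le fun ⟨rs, hrs, _⟩ => ?_
    rw [← WithBot.coe_le_coe, ← hd,
      ← ringKrullDim_add_length_eq_ringKrullDim_of_isRegular rs hrs]
    have : Nontrivial (A ⧸ Ideal.ofList rs) :=
      Ideal.Quotient.nontrivial_iff.2 (by simpa using hrs.top_ne_smul.symm)
    have h0 : (0 : WithBot ℕ∞) ≤ ringKrullDim (A ⧸ Ideal.ofList rs) :=
      ringKrullDim_nonneg_of_nontrivial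
    calc ((rs.length : ℕ∞) : WithBot ℕ∞) = 0 + (rs.length : WithBot ℕ∞) := by simp
      _ ≤ _ := by gcongr
  · obtain ⟨rs, hm, hw, hd⟩ := hA
    refine hd.trans ?_
    have hr := (isRegular_iff_isWeaklyRegular_of_subset_maximalIdeal (M := A) hm).2 hw
    exact_mod_cast WithBot.coe_le_coe.2
      (le_iSup (fun rs : {rs : List A // IsRegular A rs ∧ ∀ x ∈ rs, x ∈ maximalIdeal A} =>
        (rs.1.length : ℕ∞)) ⟨rs, hr, hm⟩)

/-- A monic polynomial is regular modulo extended ideals. -/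
lemma isSMulRegular_quotient_map_C_of_monic {A : Type*} [CommRing A] (J : Ideal A) {f : A[X]}
    (hf : f.Monic) : IsSMulRegular (A[X] ⧸ J.map C) f := by
  let e := Ideal.polynomialQuotientEquivQuotientPolynomial J
  have h1 : (f.map (Ideal.Quotient.mk J)).Monic := hf.map _
  intro u v huv
  apply e.symm.injective
  apply h1.isRegular.left
  have key : ∀ w, e.symm (f • w) = f.map (Ideal.Quotient.mk J) * e.symm w := by
    intro w
    obtain ⟨w, rfl⟩ := Ideal.Quotient.mk_surjective w
    have : f • (Ideal.Quotient.mk (J.map C) w) = Ideal.Quotient.mk (J.map C) (f * w) := rfl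
    rw [this, map_mul, map_mul]
    congr 1
  simp only [← key]
  exact congrArg e.symm huv

/-- A prime over the maximal ideal is either its extension, of the same height, or the extension
plus a monic `f`. In the second case the height grows by at most one, and `f` prolongs the sequence.
-/
lemma exists_isWeaklyRegular_polynomial {A : Type*} [CommRing A] [IsLocalRing A]
    [IsNoetherianRing A] (hA : HasLongRegularSequence A) (P : Ideal A[X]) [P.IsPrime]
    (hP : P.comap C = maximalIdeal A) :
    ∃ rs : List A[X], (∀ x ∈ rs, x ∈ P) ∧ IsWeaklyRegular A[X] rs ∧ P.height ≤ rs.length := by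
  obtain ⟨rs, hm, hw, hd⟩ := hA
  have hw' : IsWeaklyRegular A[X] (rs.map C) := hw.of_flat (S := A[X])
  have hm' : ∀ x ∈ rs.map C, x ∈ P := by
    intro x hx
    obtain ⟨y, hy, rfl⟩ := List.mem_map.1 hx
    rw [← Ideal.mem_comap, hP]; exact hm y hy
  have hd' : (maximalIdeal A).height ≤ rs.length := by
    rw [← maximalIdeal_height_eq_ringKrullDim] at hd
    exact_mod_cast hd
  by_cases hPm : P = (P.comap C).map C
  · refine ⟨rs.map C, hm', hw', ?_⟩
    rw [hPm, hP, Polynomial.height_map_C, List.length_map]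
    exact hd'
  · have hmax : (P.comap C).IsMaximal := hP ▸ maximalIdeal.isMaximal A
    obtain ⟨f, hf, hPf⟩ := Polynomial.exists_monic_span_sup_map_eq A P hmax hPm
    refine ⟨rs.map C ++ [f], ?_, ?_, ?_⟩
    · intro x hx
      rcases List.mem_append.1 hx with hx | hx
      · exact hm' x hx
      · rw [List.mem_singleton.1 hx, hPf]
        exact Ideal.mem_sup_right (Ideal.mem_span_singleton_self f)
    · rw [isWeaklyRegular_append_iff, isWeaklyRegular_singleton_iff]
      refine ⟨hw', ?_⟩
      have : Ideal.ofList (rs.map C) • (⊤ : Submodule A[X] A[X]) = (Ideal.ofList rs).map C := by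
        rw [← Ideal.map_ofList]; simp
      rw [this]
      exact isSMulRegular_quotient_map_C_of_monic _ hf
    · have : P.LiesOver (maximalIdeal A) := ⟨hP.symm⟩
      refine (Ideal.height_le_height_add_of_liesOver (maximalIdeal A) P).trans ?_
      rw [List.length_append, List.length_map, Nat.cast_add]
      refine add_le_add hd' ?_
      simp only [List.length_singleton, Nat.cast_one]
      let e := Ideal.polynomialQuotientEquivQuotientPolynomial (maximalIdeal A)
      -- The fibre over the closed point is a polynomial ring in one variable over a field, so the
      -- image of `P` has height at most one there.
      have h1 : ringKrullDim (A[X] ⧸ (maximalIdeal A).map (algebraMap A A[X])) = 1 := by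
        refine (ringKrullDim_eq_of_ringEquiv e).symm.trans ?_
        let : Field (A ⧸ maximalIdeal A) := Ideal.Quotient.field _
        rw [Polynomial.ringKrullDim_of_isNoetherianRing, ringKrullDim_eq_zero_of_field]; rfl
      have hne : P.map (Ideal.Quotient.mk ((maximalIdeal A).map (algebraMap A A[X]))) ≠ ⊤ := by
        have hle : (maximalIdeal A).map (algebraMap A A[X]) ≤ P :=
          Ideal.map_le_iff_le_comap.2 hP.ge
        have := Ideal.map_isPrime_of_surjective
          (f := Ideal.Quotient.mk ((maximalIdeal A).map (algebraMap A A[X])))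
          Ideal.Quotient.mk_surjective (I := P) (by rwa [Ideal.mk_ker])
        exact this.ne_top
      have h2 := Ideal.height_le_ringKrullDim_of_ne_top hne
      rw [h1] at h2
      exact_mod_cast h2

/-- All localizations at primes have long regular sequences. -/
def LocallyHasLongRegularSequence (A : Type*) [CommRing A] : Prop :=
  ∀ (p : Ideal A) [p.IsPrime], HasLongRegularSequence (Localization.AtPrime p)

lemma HasLongRegularSequence.of_ringEquiv {A B : Type*} [CommRing A] [CommRing B] [IsLocalRing A]
    [IsLocalRing B] (e : A ≃+* B) (hA : HasLongRegularSequence A) : HasLongRegularSequence B := by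
  let : Algebra A B := e.toRingHom.toAlgebra
  have hloc : IsLocalHom (algebraMap A B) := ⟨fun x hx => by
    have := hx.map e.symm
    rwa [show algebraMap A B x = e x from rfl, e.symm_apply_apply] at this⟩
  have hflat : Module.Flat A B :=
    Module.Flat.of_linearEquiv
      (AlgEquiv.ofRingEquiv (f := e) fun _ => rfl : A ≃ₐ[A] B).symm.toLinearEquiv
  exact hA.of_flat (ringKrullDim_eq_of_ringEquiv e).ge

lemma LocallyHasLongRegularSequence.of_ringEquiv {A B : Type*} [CommRing A] [CommRing B]
    (e : A ≃+* B) (hA : LocallyHasLongRegularSequence A) : LocallyHasLongRegularSequence B :=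
  fun p _ => HasLongRegularSequence.of_ringEquiv
    (IsLocalization.ringEquivOfRingEquiv
      (Localization.AtPrime (p.comap e)) (Localization.AtPrime p) e (e.map_primeCompl_comap_eq p))
    (hA (p.comap e))

/-- Inverting the complement of `q = p ∩ A` first replaces `A` by the local ring `A_q`; the
extension of `p` to `A_q[X]` lies over the maximal ideal, and localizing there gives `A[X]_p`. -/
lemma LocallyHasLongRegularSequence.polynomial {A : Type*} [CommRing A] [IsNoetherianRing A]
    (hA : LocallyHasLongRegularSequence A) : LocallyHasLongRegularSequence A[X] := by
  intro p hp
  let q := p.comap C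
  let S := (Localization.AtPrime q)[X]
  let pc := Submonoid.map Polynomial.C.toMonoidHom q.primeCompl
  let : Algebra A[X] S := algebra A (Localization.AtPrime q)
  have : IsLocalization pc S := Polynomial.isLocalization _ _
  let pS := p.map (algebraMap A[X] S)
  have disj : Disjoint (pc : Set A[X]) (p : Set A[X]) := by
    simpa [pc, q] using! Set.disjoint_image_left.mpr
      (Set.disjoint_compl_left_iff_subset.mpr (fun _ a ↦ a))
  have : pS.IsPrime := IsLocalization.isPrime_of_isPrime_disjoint pc _ _ ‹_› disj
  have : IsLocalization.AtPrime (Localization.AtPrime pS) p := by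
    convert IsLocalization.isLocalization_isLocalization_atPrime_isLocalization pc
      (Localization.AtPrime pS) pS
    exact (IsLocalization.under_map_of_isPrime_disjoint pc _ ‹_› disj).symm
  have eq : Ideal.comap C pS = maximalIdeal (Localization.AtPrime q) := by
    rw [← IsLocalization.map_under q.primeCompl _ (Ideal.comap C pS),
      ← IsLocalization.map_under q.primeCompl _ (maximalIdeal (Localization.AtPrime q))]
    simp only [Ideal.comap_comap, S, pS]
    rw [← Polynomial.algebraMap_eq (R := Localization.AtPrime q),
      ← IsScalarTower.algebraMap_eq A (Localization.AtPrime q) (Localization.AtPrime q)[X],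
      IsScalarTower.algebraMap_eq A A[X] (Localization.AtPrime q)[X], ← Ideal.comap_comap,
      ← Ideal.under_def A[X], IsLocalization.under_map_of_isPrime_disjoint pc _ ‹_› disj]
    simp [q, IsLocalization.AtPrime.under_maximalIdeal (Localization.AtPrime q) q]
  obtain ⟨rs, hm, hw, hd⟩ := exists_isWeaklyRegular_polynomial (hA q) pS eq
  refine HasLongRegularSequence.of_ringEquiv (IsLocalization.algEquiv p.primeCompl
    (Localization.AtPrime pS) (Localization.AtPrime p)).toRingEquiv
    ⟨rs.map (algebraMap S (Localization.AtPrime pS)), ?_, ?_, ?_⟩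
  · intro x hx
    obtain ⟨y, hy, rfl⟩ := List.mem_map.1 hx
    exact (IsLocalization.AtPrime.to_map_mem_maximal_iff _ pS y).2 (hm y hy)
  · exact hw.of_isLocalization _ pS.primeCompl
  · rw [List.length_map, IsLocalization.AtPrime.ringKrullDim_eq_height pS]
    exact_mod_cast WithBot.coe_le_coe.2 hd

lemma LocallyHasLongRegularSequence.of_field (k : Type*) [Field k] :
    LocallyHasLongRegularSequence k := by
  intro p _
  refine ⟨[], by simp, by simp, ?_⟩
  rw [IsLocalization.AtPrime.ringKrullDim_eq_height p]
  have h : (p.height : WithBot ℕ∞) ≤ ringKrullDim k :=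
    Ideal.height_le_ringKrullDim_of_ne_top (Ideal.IsPrime.ne_top ‹_›)
  simpa [ringKrullDim_eq_zero_of_field] using h

lemma LocallyHasLongRegularSequence.mvPolynomial (k : Type*) [Field k] (ι : Type*) [Finite ι] :
    LocallyHasLongRegularSequence (MvPolynomial ι k) := by
  induction ι using Finite.induction_empty_option with
  | of_equiv e H => exact .of_ringEquiv (MvPolynomial.renameEquiv _ e).toRingEquiv H
  | h_empty => exact .of_ringEquiv (MvPolynomial.isEmptyRingEquiv k _).symm (.of_field k)
  | h_option IH =>
    exact .of_ringEquiv (MvPolynomial.optionEquivLeft _ _).toRingEquiv.symm IH.polynomial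

end RegularSequences

/-! ### Dimension and regular sequences along integral extensions. -/

section IntegralExtensions

/-- Heights do not grow along integral extensions. -/
lemma Ideal.height_le_height_under_of_isIntegral {A B : Type*} [CommRing A] [CommRing B]
    [Algebra A B] [Algebra.IsIntegral A B] (P : Ideal B) [P.IsPrime] :
    P.height ≤ (P.under A).height := by
  change (⟨P, inferInstance⟩ : PrimeSpectrum B).asIdeal.height ≤
    (⟨P.under A, inferInstance⟩ : PrimeSpectrum A).asIdeal.height
  rw [PrimeSpectrum.height_eq_orderHeight, PrimeSpectrum.height_eq_orderHeight]
  exact Order.height_le_height_apply_of_strictMono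
    (fun Q : PrimeSpectrum B => PrimeSpectrum.comap (algebraMap A B) Q)
    (fun _ _ h => Ideal.IsIntegral.comap_lt_comap (R := A) h) ⟨P, inferInstance⟩

lemma ringKrullDim_le_of_isIntegral (A B : Type*) [CommRing A] [CommRing B]
    [Algebra A B] [Algebra.IsIntegral A B] : ringKrullDim B ≤ ringKrullDim A :=
  Order.krullDim_le_of_strictMono
    (fun Q : PrimeSpectrum B => PrimeSpectrum.comap (algebraMap A B) Q)
    (fun _ _ h => Ideal.IsIntegral.comap_lt_comap (R := A) h)

/-- For `P` over `p` the map `A_p → B_P` is flat and local, and incomparability bounds the height of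
`P` by that of `p`, so the sequence from `A_p` is still long enough. -/
lemma LocallyHasLongRegularSequence.of_flat_of_isIntegral {A B : Type*} [CommRing A] [CommRing B]
    [Algebra A B] [Module.Flat A B] [Algebra.IsIntegral A B]
    (hA : LocallyHasLongRegularSequence A) : LocallyHasLongRegularSequence B := by
  intro P _
  let p := P.under A
  let : Algebra (Localization.AtPrime p) (Localization.AtPrime P) :=
    (Localization.localRingHom p P (algebraMap A B) rfl).toAlgebra
  have : IsScalarTower A (Localization.AtPrime p) (Localization.AtPrime P) := by
    refine IsScalarTower.of_algebraMap_eq fun x => ?_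
    rw [RingHom.algebraMap_toAlgebra, Localization.localRingHom_to_map,
      IsScalarTower.algebraMap_apply A B]
  have hl : IsLocalHom (algebraMap (Localization.AtPrime p) (Localization.AtPrime P)) :=
    Localization.isLocalHom_localRingHom p P (algebraMap A B) rfl
  have hf : Module.Flat A (Localization.AtPrime P) := Module.Flat.trans A B _
  have hf' : Module.Flat (Localization.AtPrime p) (Localization.AtPrime P) :=
    (Module.flat_iff_of_isLocalization (Localization.AtPrime p) p.primeCompl _).2 hf
  refine (hA p).of_flat ?_
  rw [IsLocalization.AtPrime.ringKrullDim_eq_height P,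
    IsLocalization.AtPrime.ringKrullDim_eq_height p]
  exact WithBot.coe_le_coe.2 (Ideal.height_le_height_under_of_isIntegral P)

lemma LocallyHasLongRegularSequence.isCohenMacaulay {A : Type u} [CommRing A] [IsNoetherianRing A]
    (hA : LocallyHasLongRegularSequence A) : IsCohenMacaulay A :=
  ⟨inferInstance, fun p _ => by
    have : IsNoetherianRing (Localization.AtPrime p) :=
      IsLocalization.isNoetherianRing p.primeCompl _ inferInstance
    exact (hA p).isCohenMacaulayLocal⟩

/-- Lying over lifts the bottom of a chain of primes, and going up lifts the rest. -/
lemma ringKrullDim_le_of_isIntegral_of_injective (A B : Type*) [CommRing A] [CommRing B]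
    [Algebra A B] [Algebra.IsIntegral A B] (h : Function.Injective (algebraMap A B)) :
    ringKrullDim A ≤ ringKrullDim B := by
  refine iSup_le fun l => ?_
  obtain ⟨P, -, hP, hPl⟩ := Ideal.exists_ideal_over_prime_of_isIntegral
    (RelSeries.head l).asIdeal (⊥ : Ideal B)
    (by rw [← RingHom.ker_eq_comap_bot, (RingHom.injective_iff_ker_eq_bot _).1 h]; exact bot_le)
  have : P.LiesOver (RelSeries.head l).asIdeal := ⟨hPl.symm⟩
  obtain ⟨L, hL, -⟩ := Ideal.exists_ltSeries_of_hasGoingUp l P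
  rw [← hL]
  exact Order.LTSeries.length_le_krullDim L

end IntegralExtensions

/-! ### Evaluating forms in the Rees algebra. -/

section ReesEvaluation

variable {R : Type u} [CommRing R] {I : Ideal R} {ι : Type*} (x : ι → I)

/-- Evaluation of polynomials at the degree one elements of the Rees algebra given by `x`. -/
noncomputable def reesEval : MvPolynomial ι R →ₐ[R] reesAlgebra I :=
  MvPolynomial.aeval fun i => ⟨Polynomial.monomial 1 (x i : R),
    reesAlgebra.monomial_mem.2 (by rw [pow_one]; exact (x i).2)⟩

lemma coe_reesEval (h : MvPolynomial ι R) :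
    (reesEval x h : Polynomial R) =
      MvPolynomial.aeval (fun i => Polynomial.monomial 1 (x i : R)) h := by
  rw [reesEval, ← Subalgebra.coe_val, ← AlgHom.comp_apply, MvPolynomial.comp_aeval]
  rfl

lemma coe_reesEval_of_isHomogeneous {h : MvPolynomial ι R} {d : ℕ} (hh : h.IsHomogeneous d) :
    (reesEval x h : Polynomial R) =
      Polynomial.monomial d (MvPolynomial.eval (fun i => (x i : R)) h) := by
  rw [coe_reesEval]
  have h1 : ∀ m ∈ h.support, MvPolynomial.aeval (fun i => Polynomial.monomial 1 (x i : R))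
      (MvPolynomial.monomial m (h.coeff m)) = Polynomial.monomial d
        (MvPolynomial.eval (fun i => (x i : R)) (MvPolynomial.monomial m (h.coeff m))) := by
    intro m hm
    rw [MvPolynomial.aeval_monomial, MvPolynomial.eval_monomial, Polynomial.algebraMap_eq,
      ← Polynomial.C_mul_monomial]
    congr 1
    have hd : m.degree = d := by
      rw [← hh (MvPolynomial.mem_support_iff.1 hm), Finsupp.degree_eq_weight_one]; rfl
    rw [← hd, Finsupp.degree, Finsupp.prod, Finsupp.prod]
    simp only [← Polynomial.C_mul_X_pow_eq_monomial, pow_one, mul_pow, Finset.prod_mul_distrib,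
      Finset.prod_pow_eq_pow_sum, map_prod, map_pow]
    rfl
  conv_lhs => rw [h.as_sum]
  conv_rhs => rw [h.as_sum]
  rw [map_sum, map_sum, map_sum]
  exact Finset.sum_congr rfl h1

lemma coeff_reesEval (h : MvPolynomial ι R) (d : ℕ) :
    (reesEval x h : Polynomial R).coeff d =
      MvPolynomial.eval (fun i => (x i : R)) (MvPolynomial.homogeneousComponent d h) := by
  conv_lhs => rw [← MvPolynomial.sum_homogeneousComponent h]
  rw [map_sum, AddSubmonoidClass.coe_finsetSum, Polynomial.finsetSum_coeff]
  simp only [coe_reesEval_of_isHomogeneous x (MvPolynomial.homogeneousComponent_isHomogeneous _ h),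
    Polynomial.coeff_monomial]
  rw [Finset.sum_ite_eq']
  split_ifs with hd
  · rfl
  · rw [MvPolynomial.homogeneousComponent_eq_zero _ _ (by simpa using hd), map_zero]

lemma eval_mem_pow {h : MvPolynomial ι R} {d : ℕ} (hh : h.IsHomogeneous d) :
    MvPolynomial.eval (fun i => (x i : R)) h ∈ I ^ d := by
  have h1 := (Ideal.mem_span_pow_iff_exists_isHomogeneous (fun i => (x i : R)) _).2 ⟨h, hh, rfl⟩
  refine Ideal.pow_right_mono (Ideal.span_le.2 ?_) d h1
  rintro _ ⟨i, rfl⟩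
  exact (x i).2

end ReesEvaluation

/-! ### Homogeneous elements of the special fiber ring. -/

section FiberRingElements

variable {R : Type u} [CommRing R] [IsLocalRing R]

namespace SpecialFiberRing

noncomputable instance residueModule (I : Ideal R) :
    Module (ResidueField R) (SpecialFiberRing I) := Algebra.toModule

noncomputable instance residueSMul (I : Ideal R) :
    SMul (ResidueField R) (SpecialFiberRing I) := Algebra.toSMul

instance isScalarTower_residueField (I : Ideal R) :
    IsScalarTower R (ResidueField R) (SpecialFiberRing I) :=
  IsScalarTower.of_algebraMap_eq fun _ => rfl

/-- The degree `d` element of the special fiber ring given by `w ∈ I ^ d`. -/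
noncomputable def homogClass (I : Ideal R) (d : ℕ) : ↥(I ^ d) →ₗ[R] SpecialFiberRing I where
  toFun w := Ideal.Quotient.mk _ ⟨Polynomial.monomial d (w : R), reesAlgebra.monomial_mem.2 w.2⟩
  map_add' v w := by
    rw [← map_add]; congr 1; ext1; simp
  map_smul' c w := by
    change _ = Ideal.Quotient.mk _ (c • _)
    congr 1; ext1
    exact (Polynomial.smul_monomial c d (w : R)).symm

variable {I : Ideal R}

/-- The condition holds for constants from `𝔪`, and multiplication by elements of the Rees algebra
preserves it because `I ^ i · 𝔪 I ^ j = 𝔪 I ^ (i + j)`. -/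
lemma coeff_mem_of_mk_eq_zero {p : reesAlgebra I}
    (hp : (Ideal.Quotient.mk _ p : SpecialFiberRing I) = 0) (d : ℕ) :
    (p : Polynomial R).coeff d ∈ maximalIdeal R * I ^ d := by
  rw [Ideal.Quotient.eq_zero_iff_mem, Ideal.map] at hp
  induction hp using Submodule.span_induction generalizing d with
  | mem x hx =>
    obtain ⟨r, hr, rfl⟩ := hx
    have : ((algebraMap R (reesAlgebra I) r : reesAlgebra I) : Polynomial R) = Polynomial.C r := rfl
    rw [this, Polynomial.coeff_C]
    split_ifs with h
    · subst h; simpa using hr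
    · exact zero_mem _
  | zero => simp
  | add x y _ _ hx hy => simpa using add_mem (hx d) (hy d)
  | smul a x _ hx =>
    have key : ∀ q : Polynomial R, q ∈ reesAlgebra I → ∀ p : Polynomial R,
        (∀ d, p.coeff d ∈ maximalIdeal R * I ^ d) →
        ∀ d, (q * p).coeff d ∈ maximalIdeal R * I ^ d := by
      intro q hq p hp d
      rw [Polynomial.coeff_mul]
      refine Ideal.sum_mem _ fun ij hij => ?_
      rw [← Finset.HasAntidiagonal.mem_antidiagonal.1 hij, pow_add, mul_left_comm]
      exact Ideal.mul_mem_mul (hq _) (hp _)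
    exact key a a.2 x hx d

/-- Identifies the degree `d` part of the fiber ring with `I ^ d / 𝔪 I ^ d`. -/
lemma homogClass_eq_zero_iff {d : ℕ} {w : ↥(I ^ d)} :
    homogClass I d w = 0 ↔ (w : R) ∈ maximalIdeal R * I ^ d := by
  constructor
  · intro h
    simpa using coeff_mem_of_mk_eq_zero h d
  · intro h
    have hle : (maximalIdeal R * I ^ d) ≤ (Submodule.map (Submodule.subtype (I ^ d))
        (LinearMap.ker (homogClass I d))) := by
      refine Submodule.mul_le.2 fun m hm n hn => ⟨m • ⟨n, hn⟩, ?_, rfl⟩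
      rw [SetLike.mem_coe, LinearMap.mem_ker, map_smul]
      change Ideal.Quotient.mk _ (m • _) = 0
      rw [Algebra.smul_def, map_mul,
        Ideal.Quotient.eq_zero_iff_mem.2 (Ideal.mem_map_of_mem _ hm), zero_mul]
    obtain ⟨v, hv, hvw⟩ := hle h
    rwa [show w = v from Subtype.ext hvw.symm]

/-- `SpecialFiberRing.ofIdeal` as a linear map. -/
noncomputable def ofIdealₗ (I : Ideal R) : I →ₗ[R] SpecialFiberRing I where
  toFun := ofIdeal I
  map_add' v w := (homogClass I 1).map_add ⟨v, by rw [pow_one]; exact v.2⟩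
    ⟨w, by rw [pow_one]; exact w.2⟩
  map_smul' c w := (homogClass I 1).map_smul c ⟨w, by rw [pow_one]; exact w.2⟩

lemma ofIdealₗ_apply (x : I) : ofIdealₗ I x = ofIdeal I x := rfl

lemma ofIdeal_eq_zero_iff {x : I} : ofIdeal I x = 0 ↔ (x : R) ∈ maximalIdeal R * I := by
  have h := homogClass_eq_zero_iff (I := I) (d := 1) (w := ⟨x, by rw [pow_one]; exact x.2⟩)
  simp only [pow_one] at h
  exact h

lemma ofIdeal_mul_homogClass {d : ℕ} (v : I) (w : ↥(I ^ d)) :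
    ofIdeal I v * homogClass I d w =
      homogClass I (d + 1) ⟨v * w, by rw [pow_succ']; exact Ideal.mul_mem_mul v.2 w.2⟩ := by
  change Ideal.Quotient.mk _ _ * Ideal.Quotient.mk _ _ = Ideal.Quotient.mk _ _
  rw [← map_mul]
  congr 1; ext1
  refine (Polynomial.monomial_mul_monomial _ _ _ _).trans ?_
  rw [add_comm]

lemma eq_sum_homogClass (p : reesAlgebra I) :
    (Ideal.Quotient.mk _ p : SpecialFiberRing I) =
      ∑ d ∈ (p : Polynomial R).support, homogClass I d ⟨(p : Polynomial R).coeff d, p.2 d⟩ := by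
  change _ = ∑ d ∈ (p : Polynomial R).support, Ideal.Quotient.mk _ _
  rw [← map_sum]
  congr 1; ext1
  rw [AddSubmonoidClass.coe_finsetSum]
  exact (p : Polynomial R).as_sum_support

/-- Additive predicates on the special fiber ring can be checked on homogeneous elements. -/
lemma mem_of_forall_homogClass_mem {S : Type*} [SetLike S (SpecialFiberRing I)]
    [AddSubmonoidClass S (SpecialFiberRing I)] (N : S) (h : ∀ d w, homogClass I d w ∈ N)
    (z : SpecialFiberRing I) : z ∈ N := by
  obtain ⟨p, rfl⟩ := Ideal.Quotient.mk_surjective z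
  rw [eq_sum_homogClass]
  exact sum_mem fun d _ => h d _

section Evaluation

variable {ι : Type*} (x : ι → I)

/-- Evaluation of polynomials over the residue field at degree one elements of the fiber ring. -/
noncomputable def fiberEval :
    MvPolynomial ι (ResidueField R) →ₐ[ResidueField R] SpecialFiberRing I :=
  MvPolynomial.aeval fun i => ofIdeal I (x i)

lemma fiberEval_X (i : ι) : fiberEval x (MvPolynomial.X i) = ofIdeal I (x i) := by
  simp [fiberEval]

/-- Links forms over the residue field to their lifts over `R`: both sides are `R`-algebra maps in
`h` that agree on the variables. -/
lemma fiberEval_map (h : MvPolynomial ι R) :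
    fiberEval x (h.map (residue R)) = Ideal.Quotient.mk _ (reesEval x h) := by
  have : ((fiberEval x).restrictScalars R).comp
      (MvPolynomial.mapAlgHom (IsScalarTower.toAlgHom R R (ResidueField R))) =
      (Ideal.Quotient.mkₐ R _).comp (reesEval x) := by
    ext i
    simp [fiberEval, reesEval, ofIdeal]
  exact DFunLike.congr_fun this h

lemma fiberEval_map_of_isHomogeneous {h : MvPolynomial ι R} {d : ℕ} (hh : h.IsHomogeneous d)
    (hm : MvPolynomial.eval (fun i => (x i : R)) h ∈ I ^ d) :
    fiberEval x (h.map (residue R)) = homogClass I d ⟨_, hm⟩ := by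
  rw [fiberEval_map]
  change _ = Ideal.Quotient.mk _ _
  congr 1; ext1
  exact coe_reesEval_of_isHomogeneous x hh

lemma fiberEval_map_eq_zero {h : MvPolynomial ι R} {d : ℕ} (hh : h.IsHomogeneous d)
    (h0 : MvPolynomial.eval (fun i => (x i : R)) h ∈ maximalIdeal R * I ^ d) :
    fiberEval x (h.map (residue R)) = 0 := by
  rw [fiberEval_map_of_isHomogeneous x hh (eval_mem_pow x hh), homogClass_eq_zero_iff]
  exact h0

lemma eval_homogeneousComponent_mem {h : MvPolynomial ι R}
    (h0 : fiberEval x (h.map (residue R)) = 0) (d : ℕ) :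
    MvPolynomial.eval (fun i => (x i : R)) (MvPolynomial.homogeneousComponent d h) ∈
      maximalIdeal R * I ^ d := by
  rw [fiberEval_map] at h0
  rw [← coeff_reesEval]
  exact coeff_mem_of_mk_eq_zero h0 d

lemma fiberEval_surjective (hx : Ideal.span (Set.range fun i => (x i : R)) = I) :
    Function.Surjective (fiberEval x) := by
  rw [← AlgHom.range_eq_top, eq_top_iff]
  intro z _
  refine mem_of_forall_homogClass_mem (fiberEval x).range (fun d w => ?_) z
  obtain ⟨h, hh, hw⟩ := (Ideal.mem_span_pow_iff_exists_isHomogeneous (fun i => (x i : R)) w.1).1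
    (by rw [hx]; exact w.2)
  refine ⟨h.map (residue R), ?_⟩
  have := fiberEval_map_of_isHomogeneous x hh (eval_mem_pow x hh)
  simp only [hw] at this
  exact this

end Evaluation

/-- A combination of the classes of the `b i` lifts to the Rees algebra up to an element of the
extension of `𝔪`; it remains to compare coefficients in degree `N + 1`. -/
lemma mem_of_homogClass_mem_span {ι : Type*} [Finite ι] (b : ι → I) {N : ℕ} (w : ↥(I ^ (N + 1)))
    (hw : homogClass I (N + 1) w ∈ Ideal.span (Set.range fun i => ofIdeal I (b i))) :
    (w : R) ∈ Ideal.span (Set.range fun i => (b i : R)) * I ^ N ⊔ maximalIdeal R * I ^ (N + 1) := by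
  have := Fintype.ofFinite ι
  obtain ⟨q, hq⟩ := (Ideal.mem_span_range_iff_exists_fun).1 hw
  choose p hp using fun i => Ideal.Quotient.mk_surjective (q i)
  have h0 : (Ideal.Quotient.mk _ ((⟨Polynomial.monomial (N + 1) (w : R),
      reesAlgebra.monomial_mem.2 w.2⟩ : reesAlgebra I) - ∑ i, p i * ⟨Polynomial.monomial 1
        (b i : R),
        reesAlgebra.monomial_mem.2 (by rw [pow_one]; exact
          (b i).2)⟩) : SpecialFiberRing I) = 0 := by
    rw [map_sub, map_sum, sub_eq_zero]
    simp only [map_mul, hp]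
    exact hq.symm
  have h1 := coeff_mem_of_mk_eq_zero h0 (N + 1)
  rw [AddSubgroupClass.coe_sub, AddSubmonoidClass.coe_finsetSum, Polynomial.coeff_sub,
    Polynomial.finsetSum_coeff] at h1
  simp only [MulMemClass.coe_mul, Polynomial.coeff_monomial, Polynomial.coeff_mul_monomial,
    if_true] at h1
  rw [← sub_add_cancel (w : R) (∑ i, (p i : Polynomial R).coeff N * (b i : R))]
  refine add_mem (Ideal.mem_sup_right h1) (Ideal.mem_sup_left (Ideal.sum_mem _ fun i _ => ?_))
  rw [mul_comm]
  exact Ideal.mul_mem_mul ((p i).2 N) (Ideal.subset_span (Set.mem_range_self i))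

end SpecialFiberRing

end FiberRingElements

/-! ### Colon conditions and the rewriting of relations. -/

section Koszul

open MvPolynomial

variable {R : Type u} [CommRing R] {ℓ : ℕ}

/-- The ideal generated by the first `m` elements of a sequence. -/
def initialSpan (a : Fin ℓ → R) (m : ℕ) : Ideal R := Ideal.span (a '' {i | (i : ℕ) < m})

lemma mem_initialSpan (a : Fin ℓ → R) {m : ℕ} {i : Fin ℓ} (h : (i : ℕ) < m) :
    a i ∈ initialSpan a m := Ideal.subset_span ⟨i, h, rfl⟩

lemma initialSpan_eq_span_range (a : Fin ℓ → R) : initialSpan a ℓ = Ideal.span (Set.range a) := by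
  simp [initialSpan]

lemma initialSpan_eq_span_image_Iio (a : Fin ℓ → R) (i : Fin ℓ) :
    initialSpan a i = Ideal.span (a '' Set.Iio i) := rfl

lemma initialSpan_succ (a : Fin ℓ → R) {m : ℕ} (hm : m < ℓ) :
    initialSpan a (m + 1) = initialSpan a m ⊔ Ideal.span {a ⟨m, hm⟩} := by
  rw [initialSpan, initialSpan, ← Ideal.span_union, ← Set.image_singleton, ← Set.image_union]
  congr 2
  ext i
  simp [Fin.ext_iff, le_iff_lt_or_eq, or_comm]

lemma initialSpan_mono (a : Fin ℓ → R) {m n : ℕ} (h : m ≤ n) :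
    initialSpan a m ≤ initialSpan a n :=
  Ideal.span_mono (Set.image_mono fun _ hi => lt_of_lt_of_le hi h)

/-- If `I ^ (s + 2) = J I ^ (s + 1)` for `J` generated by the sequence `a`, then the colon
conditions on `a` with respect to `I ^ (s + 1)` propagate to all higher powers of `I`. -/
lemma colon_condition_of_le {I : Ideal R} {a : Fin ℓ → R} {s : ℕ}
    (ha : ∀ i, a i ∈ I) (hJ : I ^ (s + 2) = Ideal.span (Set.range a) * I ^ (s + 1))
    (h : ∀ i : Fin ℓ, ∀ x ∈ I ^ (s + 1), a i * x ∈ initialSpan a i * I ^ s →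
      x ∈ initialSpan a i * I ^ s) (n : ℕ) :
    ∀ i : Fin ℓ, ∀ x ∈ I ^ (s + 1 + n), a i * x ∈ initialSpan a i * I ^ (s + n) →
      x ∈ initialSpan a i * I ^ (s + n) := by
  induction n with
  | zero => exact h
  | succ n ih =>
    intro i x hx hax
    have hle : ∀ m, initialSpan a m * I ^ (s + (n + 1)) ≤ initialSpan a m * I ^ (s + n) :=
      fun m => Ideal.mul_mono_right (Ideal.pow_le_pow_right (by lia))
    have hx' : x ∈ initialSpan a i * I ^ (s + n) :=
      ih i x (Ideal.pow_le_pow_right (by lia) hx) (hle _ hax)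
    -- Descent from `m = ℓ`, where `I ^ (s + n + 2) = (a) I ^ (s + n + 1)` applies, to `m = i`. If
    -- `x = u + a_m z`, the previous exponent puts `z` in `(a_j : j < m) I ^ (s + n)`, and the
    -- factor `a_m ∈ I` restores the missing power.
    refine Nat.decreasingInduction' (m := i) (n := ℓ)
      (P := fun m => x ∈ initialSpan a m * I ^ (s + (n + 1))) ?_ i.2.le ?_
    · intro m hm him hxm
      rw [initialSpan_succ a hm, Ideal.sup_mul, Submodule.mem_sup] at hxm
      obtain ⟨u, hu, v, hv, rfl⟩ := hxm
      obtain ⟨z, hz, rfl⟩ := Ideal.mem_span_singleton_mul.1 hv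
      have hxm' : u + a ⟨m, hm⟩ * z ∈ initialSpan a m * I ^ (s + n) :=
        Ideal.mul_mono_left (initialSpan_mono a him) hx'
      have hz' : z ∈ initialSpan a m * I ^ (s + n) := by
        refine ih ⟨m, hm⟩ z (by rwa [show s + 1 + n = s + (n + 1) by lia]) ?_
        exact (Ideal.add_mem_iff_right _ (hle _ hu)).1 hxm'
      refine add_mem hu ?_
      rw [← add_assoc, pow_succ, ← mul_assoc, mul_comm (a _) z]
      exact Ideal.mul_mem_mul hz' (ha _)
    · rw [initialSpan_eq_span_range]
      have : I ^ (s + 1 + (n + 1)) = Ideal.span (Set.range a) * I ^ (s + (n + 1)) := by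
        rw [show s + 1 + (n + 1) = (s + 2) + n by lia, pow_add, hJ, mul_assoc, ← pow_add]
        congr 2; lia
      exact this ▸ hx

/-- Elements of `(a₁, …, aₘ) I ^ d` are values of linear combinations of forms of degree `d`. -/
lemma exists_isHomogeneous_of_mem_initialSpan_mul {ι : Type*} (x : ι → R) (a : Fin ℓ → R)
    (m d : ℕ) {w : R} (hw : w ∈ initialSpan a m * Ideal.span (Set.range x) ^ d) :
    ∃ u : Fin ℓ → MvPolynomial ι R, (∀ i, (u i).IsHomogeneous d) ∧ (∀ i : Fin ℓ, m ≤ (i : ℕ) →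
      u i = 0) ∧
      w = ∑ i, a i * eval x (u i) := by
  refine Submodule.mul_induction_on hw ?_ ?_
  · intro p hp q hq
    obtain ⟨f, hf, rfl⟩ := (Ideal.mem_span_pow_iff_exists_isHomogeneous x q).1 hq
    rw [initialSpan] at hp
    induction hp using Submodule.span_induction with
    | mem p hp =>
      obtain ⟨i, hi, rfl⟩ := hp
      refine ⟨Pi.single i f, fun j => ?_, fun j hj => ?_, ?_⟩
      · rcases eq_or_ne j i with rfl | h
        · simpa using hf
        · simpa [h] using isHomogeneous_zero _ _ _
      · have : j ≠ i := by rintro rfl; exact absurd hi (not_lt.2 hj)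
        simp [this]
      · rw [Finset.sum_eq_single i (fun j _ hj => by simp [hj]) (by simp), Pi.single_eq_same]
    | zero => exact ⟨0, fun _ => isHomogeneous_zero _ _ _, fun _ _ => rfl, by simp⟩
    | add p p' _ _ h h' =>
      obtain ⟨u, hu, hu0, hue⟩ := h
      obtain ⟨u', hu', hu0', hue'⟩ := h'
      refine ⟨u + u', fun i => (hu i).add (hu' i), fun i hi => by simp [hu0 i hi, hu0' i hi], ?_⟩
      simp [add_mul, hue, hue', mul_add, Finset.sum_add_distrib]
    | smul c p _ h =>
      obtain ⟨u, hu, hu0, hue⟩ := h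
      refine ⟨fun i => C c * u i, fun i => (hu i).C_mul c, fun i hi => by simp [hu0 i hi], ?_⟩
      rw [smul_eq_mul, mul_assoc, hue, Finset.mul_sum]
      exact Finset.sum_congr rfl fun i _ => by simp; ring
  · rintro p p' ⟨u, hu, hu0, rfl⟩ ⟨u', hu', hu0', rfl⟩
    refine ⟨u + u', fun i => (hu i).add (hu' i), fun i hi => by simp [hu0 i hi, hu0' i hi], ?_⟩
    simp [mul_add, Finset.sum_add_distrib]

/-- Relations that are combinations of the last `ℓ` variables are combinations of relations. -/
lemma exists_relations_of_sum_eq_zero {I : Ideal R} {a : Fin ℓ → R} {y : R} {d : ℕ}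
    (hI : Ideal.span (Set.range (Fin.cons y a : Fin (ℓ + 1) → R)) = I)
    (h : ∀ i : Fin ℓ, ∀ x ∈ I ^ (d + 1), a i * x ∈ initialSpan a i * I ^ d →
      x ∈ initialSpan a i * I ^ d) (m : ℕ) :
    ∀ z : Fin ℓ → MvPolynomial (Fin (ℓ + 1)) R, (∀ i, (z i).IsHomogeneous (d + 1)) →
      (∀ i : Fin ℓ, m ≤ (i : ℕ) → z i = 0) →
      eval (Fin.cons y a : Fin (ℓ + 1) → R) (∑ i, X i.succ * z i) = 0 →
      ∃ w : Fin ℓ → MvPolynomial (Fin (ℓ + 1)) R, (∀ i, (w i).IsHomogeneous (d + 1)) ∧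
        (∀ i, eval (Fin.cons y a : Fin (ℓ + 1) → R) (w i) = 0) ∧
        ∑ i, X i.succ * z i = ∑ i, X i.succ * w i := by
  induction m with
  | zero =>
    intro z _ hz0 _
    exact ⟨0, fun _ => isHomogeneous_zero _ _ _, fun _ => by simp, by simp [hz0]⟩
  | succ m ih =>
    intro z hz hz0 hsum
    by_cases hm : ℓ ≤ m
    · exact ih z hz (fun i hi => absurd i.2 (by lia)) hsum
    push Not at hm
    let i₀ : Fin ℓ := ⟨m, hm⟩
    set e := eval (Fin.cons y a : Fin (ℓ + 1) → R) with he
    have heX : ∀ i : Fin ℓ, e (X i.succ) = a i := fun i => by simp [he]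
    have hmem : ∀ {f : MvPolynomial (Fin (ℓ + 1)) R} {n : ℕ}, f.IsHomogeneous n → e f ∈ I ^ n := by
      intro f n hf
      rw [← hI]
      exact (Ideal.mem_span_pow_iff_exists_isHomogeneous _ _).2 ⟨f, hf, rfl⟩
    -- The terms beyond `i₀` are zero, so the relation expresses `a i₀ * e (z i₀)` through the
    -- earlier `a i`, and the colon condition cancels `a i₀`.
    have hzm : e (z i₀) ∈ initialSpan a i₀ * I ^ d := by
      refine h i₀ _ (hmem (hz i₀)) ?_
      have h1 : a i₀ * e (z i₀) = -∑ i ∈ Finset.univ.erase i₀, a i * e (z i) := by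
        rw [map_sum, ← Finset.add_sum_erase _ _ (Finset.mem_univ i₀)] at hsum
        simp only [map_mul, heX] at hsum
        exact eq_neg_of_add_eq_zero_left hsum
      rw [h1]
      refine neg_mem (Ideal.sum_mem _ fun i hi => ?_)
      by_cases him : (i : ℕ) < m
      · exact Ideal.mul_mem_mul (mem_initialSpan a him)
          (Ideal.pow_le_pow_right (Nat.le_succ d) (hmem (hz i)))
      · have : i ≠ i₀ := Finset.ne_of_mem_erase hi
        have : (i : ℕ) ≠ m := fun h => this (Fin.ext h)
        rw [hz0 i (by lia)]
        simp
    obtain ⟨u, hu, hu0, hue⟩ := exists_isHomogeneous_of_mem_initialSpan_mul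
      (Fin.cons y a : Fin (ℓ + 1) → R) a m d (by rw [hI]; exact hzm)
    -- Here `z i₀` is the relation `w₀` plus `∑ Xᵢ uᵢ`; the latter is moved to the indices below
    -- `i₀` by regrouping `X_{i₀} (Xᵢ uᵢ)` as `Xᵢ (X_{i₀} uᵢ)`.
    let z' : Fin ℓ → MvPolynomial (Fin (ℓ + 1)) R :=
      fun i => Function.update z i₀ 0 i + X i₀.succ * u i
    let w₀ := z i₀ - ∑ i, X i.succ * u i
    have hw₀ : w₀.IsHomogeneous (d + 1) := (hz i₀).sub
      (IsHomogeneous.sum _ _ _ fun i _ => add_comm 1 d ▸ (isHomogeneous_X _ _).mul (hu i))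
    have hew₀ : e w₀ = 0 := by
      simp only [w₀, map_sub, map_sum, map_mul, heX, hue]
      exact sub_self _
    have hupd : ∑ i, X i.succ * Function.update z i₀ 0 i + X i₀.succ * z i₀ =
        ∑ i, X i.succ * z i := by
      rw [← Finset.sum_erase_add _ _ (Finset.mem_univ i₀),
        ← Finset.sum_erase_add (a := i₀) _ (fun i => X i.succ * z i) (Finset.mem_univ i₀),
        Function.update_self, mul_zero, add_zero]
      congr 1
      exact Finset.sum_congr rfl fun i hi => by
        rw [Function.update_of_ne (Finset.ne_of_mem_erase hi)]
    have hdecomp : ∑ i, X i.succ * z i = X i₀.succ * w₀ + ∑ i, X i.succ * z' i := by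
      rw [← hupd]
      simp only [z', w₀, mul_add, Finset.sum_add_distrib, mul_sub, Finset.mul_sum]
      have : ∀ i : Fin ℓ, (X i.succ : MvPolynomial (Fin (ℓ + 1)) R) * (X i₀.succ * u i) =
        X i₀.succ * (X i.succ * u i) := fun i => mul_left_comm _ _ _
      simp only [this]
      ring
    obtain ⟨w, hw, hew, hsw⟩ := ih z' (fun i => by
        refine IsHomogeneous.add ?_ (add_comm 1 d ▸ (isHomogeneous_X _ _).mul (hu i))
        rcases eq_or_ne i i₀ with rfl | hi
        · rw [Function.update_self]; exact isHomogeneous_zero _ _ _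
        · rw [Function.update_of_ne hi]; exact hz i)
      (fun i hi => by
        simp only [z', hu0 i hi, mul_zero, add_zero]
        rcases eq_or_ne i i₀ with rfl | hne
        · rw [Function.update_self]
        · rw [Function.update_of_ne hne]
          have : (i : ℕ) ≠ m := fun h => hne (Fin.ext h)
          exact hz0 i (by lia))
      (by
        rw [hdecomp, map_add, map_mul, hew₀, mul_zero, zero_add] at hsum
        exact hsum)
    refine ⟨w + Pi.single i₀ w₀, fun i => (hw i).add ?_, fun i => ?_, ?_⟩
    · rcases eq_or_ne i i₀ with rfl | hi
      · rw [Pi.single_eq_same]; exact hw₀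
      · rw [Pi.single_eq_of_ne hi]; exact isHomogeneous_zero _ _ _
    · rw [Pi.add_apply, map_add, hew i, zero_add]
      rcases eq_or_ne i i₀ with rfl | hi
      · rw [Pi.single_eq_same]; exact hew₀
      · rw [Pi.single_eq_of_ne hi, map_zero]
    · rw [hdecomp, hsw]
      simp only [Pi.add_apply, mul_add, Finset.sum_add_distrib]
      refine (add_comm _ _).trans (congrArg _ ?_)
      rw [Finset.sum_eq_single i₀ (fun j _ hj => by simp [hj]) (by simp), Pi.single_eq_same]

/-- A form of positive degree is a combination of the last variables plus a multiple of a power of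
the first one. -/
lemma MvPolynomial.IsHomogeneous.exists_eq_sum_X_succ_mul_add {d : ℕ}
    {h : MvPolynomial (Fin (ℓ + 1)) R} (hh : h.IsHomogeneous (d + 1)) :
    ∃ (z : Fin ℓ → MvPolynomial (Fin (ℓ + 1)) R) (c : R), (∀ i, (z i).IsHomogeneous d) ∧
      h = ∑ i, X i.succ * z i + C c * X 0 ^ (d + 1) := by
  rw [h.as_sum]
  refine Finset.sum_induction _ (fun f => ∃ (z : Fin ℓ → MvPolynomial (Fin (ℓ + 1)) R) (c : R),
    (∀ i, (z i).IsHomogeneous d) ∧ f = ∑ i, X i.succ * z i + C c * X 0 ^ (d + 1)) ?_ ?_ ?_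
  · rintro f f' ⟨z, c, hz, rfl⟩ ⟨z', c', hz', rfl⟩
    refine ⟨z + z', c + c', fun i => (hz i).add (hz' i), ?_⟩
    simp only [Pi.add_apply, mul_add, Finset.sum_add_distrib, map_add]
    ring
  · exact ⟨0, 0, fun _ => isHomogeneous_zero _ _ _, by simp⟩
  · intro m hm
    have hdeg : m.degree = d + 1 := by
      rw [← hh (mem_support_iff.1 hm), Finsupp.degree_eq_weight_one]; rfl
    by_cases hex : ∃ i : Fin ℓ, m i.succ ≠ 0
    · obtain ⟨i, hi⟩ := hex
      have hle : Finsupp.single i.succ 1 ≤ m := by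
        rw [Finsupp.single_le_iff]; lia
      refine ⟨Pi.single i (monomial (m - Finsupp.single i.succ 1) (coeff m h)), 0, fun j => ?_, ?_⟩
      · rcases eq_or_ne j i with rfl | hj
        · rw [Pi.single_eq_same]
          refine isHomogeneous_monomial _ ?_
          have := congrArg Finsupp.degree (tsub_add_cancel_of_le hle)
          rw [map_add, Finsupp.degree_single, hdeg] at this
          lia
        · rw [Pi.single_eq_of_ne hj]; exact isHomogeneous_zero _ _ _
      · rw [Finset.sum_eq_single i (fun j _ hj => by simp [hj]) (by simp), Pi.single_eq_same,
          C_0, zero_mul, add_zero, X, monomial_mul, one_mul, add_tsub_cancel_of_le hle]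
    · push Not at hex
      refine ⟨0, coeff m h, fun _ => isHomogeneous_zero _ _ _, ?_⟩
      have hm0 : m = Finsupp.single 0 (d + 1) := by
        have h0 : m = Finsupp.single 0 (m 0) := by
          ext j
          refine Fin.cases ?_ (fun j => ?_) j
          · simp
          · simp [hex j]
        rw [h0, Finsupp.degree_single] at hdeg
        rw [h0, hdeg]
      rw [hm0]
      simp [C_mul_X_pow_eq_monomial]

end Koszul

/-! ### The ideal of relations modulo the maximal ideal. -/

section Relations

open MvPolynomial

variable {R : Type u} [CommRing R] {ℓ : ℕ}

/-- Every product in the expansion of the power has a factor in `J` and the others in `K`, except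
the pure power of `y`. -/
lemma Ideal.sup_span_singleton_pow_le {A : Type*} [CommRing A] {J K : Ideal A} {y : A} (hJ : J ≤ K)
    (hy : y ∈ K) (d : ℕ) :
    (J ⊔ Ideal.span {y}) ^ (d + 1) ≤ J * K ^ d ⊔ Ideal.span {y ^ (d + 1)} := by
  induction d with
  | zero => simp
  | succ d ih =>
    rw [pow_succ]
    refine (Ideal.mul_mono_left ih).trans ?_
    have hle : J ⊔ Ideal.span {y} ≤ K := sup_le hJ ((Ideal.span_singleton_le_iff_mem _).2 hy)
    rw [Ideal.sup_mul, Ideal.mul_sup, Ideal.mul_sup, Ideal.span_singleton_mul_span_singleton,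
      ← pow_succ]
    refine sup_le (sup_le ?_ ?_) (sup_le ?_ le_sup_right)
    · refine le_sup_of_le_left ?_
      rw [pow_succ, ← mul_assoc]; exact Ideal.mul_mono_right hJ
    · refine le_sup_of_le_left ?_
      rw [pow_succ, ← mul_assoc]
      exact Ideal.mul_mono_right ((Ideal.span_singleton_le_iff_mem _).2 hy)
    · refine le_sup_of_le_left ?_
      rw [mul_comm]
      refine Ideal.mul_mono_right ((Ideal.span_singleton_le_iff_mem _).2 ?_)
      exact Ideal.pow_mem_pow hy _

/-- The form `X₀ ^ d - ∑ Xᵢ vᵢ`. -/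
noncomputable def monicForm (v : Fin ℓ → MvPolynomial (Fin (ℓ + 1)) R) (d : ℕ) :
    MvPolynomial (Fin (ℓ + 1)) R := X 0 ^ d - ∑ i, X i.succ * v i

/-- The data of a ring of relations: generators `y, a₁, …, a_ℓ` of `I` such that
`I ^ (s + 2) = (a) I ^ (s + 1)` and `I ^ (s + 1) ≠ (a) I ^ s`, and the colon conditions. -/
structure ColonSequence (I : Ideal R) (a : Fin ℓ → R) (y : R) (s : ℕ) : Prop where
  span_eq : Ideal.span (Set.range (Fin.cons y a : Fin (ℓ + 1) → R)) = I
  pow_eq : I ^ (s + 2) = Ideal.span (Set.range a) * I ^ (s + 1)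
  not_le : ¬ I ^ (s + 1) ≤ Ideal.span (Set.range a) * I ^ s
  colon : ∀ i : Fin ℓ, ∀ x ∈ I ^ (s + 1), a i * x ∈ initialSpan a i * I ^ s →
    x ∈ initialSpan a i * I ^ s

namespace ColonSequence

variable {I : Ideal R} {a : Fin ℓ → R} {y : R} {s : ℕ}

lemma mem (H : ColonSequence I a y s) (i : Fin ℓ) : a i ∈ I := by
  rw [← H.span_eq]; exact Ideal.subset_span ⟨i.succ, by simp⟩

lemma mem_left (H : ColonSequence I a y s) : y ∈ I := by
  rw [← H.span_eq]; exact Ideal.subset_span ⟨0, by simp⟩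

lemma span_range_le (H : ColonSequence I a y s) : Ideal.span (Set.range a) ≤ I :=
  Ideal.span_le.2 (by rintro _ ⟨i, rfl⟩; exact H.mem i)

lemma eq_sup (H : ColonSequence I a y s) : I = Ideal.span (Set.range a) ⊔ Ideal.span {y} := by
  rw [← H.span_eq, Fin.range_cons, Set.insert_eq, Ideal.span_union, sup_comm]

lemma eval_mem (H : ColonSequence I a y s) {n : ℕ} {f : MvPolynomial (Fin (ℓ + 1)) R}
    (hf : f.IsHomogeneous n) :
    eval (Fin.cons y a : Fin (ℓ + 1) → R) f ∈ I ^ n := by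
  rw [← H.span_eq]
  exact (Ideal.mem_span_pow_iff_exists_isHomogeneous _ _).2 ⟨f, hf, rfl⟩

lemma exists_relations (H : ColonSequence I a y s) (n : ℕ)
    (z : Fin ℓ → MvPolynomial (Fin (ℓ + 1)) R)
    (hz : ∀ i, (z i).IsHomogeneous (s + 1 + n))
    (h0 : eval (Fin.cons y a : Fin (ℓ + 1) → R) (∑ i, X i.succ * z i) = 0) :
    ∃ w : Fin ℓ → MvPolynomial (Fin (ℓ + 1)) R, (∀ i, (w i).IsHomogeneous (s + 1 + n)) ∧
      (∀ i, eval (Fin.cons y a : Fin (ℓ + 1) → R) (w i) = 0) ∧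
      ∑ i, X i.succ * z i = ∑ i, X i.succ * w i := by
  have h1 := colon_condition_of_le H.mem H.pow_eq H.colon n
  rw [add_right_comm] at h1 hz ⊢
  exact exists_relations_of_sum_eq_zero H.span_eq h1 ℓ z hz
    (fun i hi => absurd i.2 (not_lt.2 hi)) h0

/-- Expresses that `y ^ (s + 2)` lies in `I ^ (s + 2) = (a) I ^ (s + 1)`. -/
lemma exists_monicForm (H : ColonSequence I a y s) : ∃ v : Fin ℓ → MvPolynomial (Fin (ℓ + 1)) R,
    (∀ i, (v i).IsHomogeneous (s + 1)) ∧
      eval (Fin.cons y a : Fin (ℓ + 1) → R) (monicForm v (s + 2)) = 0 := by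
  have h1 : y ^ (s + 2) ∈ initialSpan a ℓ *
      Ideal.span (Set.range (Fin.cons y a : Fin (ℓ + 1) → R)) ^ (s + 1) := by
    rw [H.span_eq, initialSpan_eq_span_range, ← H.pow_eq]
    exact Ideal.pow_mem_pow H.mem_left _
  obtain ⟨v, hv, -, he⟩ := exists_isHomogeneous_of_mem_initialSpan_mul _ a ℓ (s + 1) h1
  refine ⟨v, hv, ?_⟩
  simp [monicForm, he]

section LocalRing

variable [IsLocalRing R]

/-- A relation of degree `s + 1` does not involve the pure power of the first variable with a unit
coefficient. -/
lemma mem_maximalIdeal_of_eval_eq_zero (H : ColonSequence I a y s)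
    {z : Fin ℓ → MvPolynomial (Fin (ℓ + 1)) R} {c : R}
    (hz : ∀ i, (z i).IsHomogeneous s)
    (h0 : eval (Fin.cons y a : Fin (ℓ + 1) → R) (∑ i, X i.succ * z i + C c * X 0 ^ (s + 1)) = 0) :
    c ∈ maximalIdeal R := by
  by_contra hc
  rw [mem_maximalIdeal, mem_nonunits_iff, not_not] at hc
  -- If `c` is a unit, the relation solves for `y ^ (s + 1)`; then all of `I ^ (s + 1)` lies in `(a)
  -- I ^ s`, against `not_le`.
  have hy : y ^ (s + 1) ∈ Ideal.span (Set.range a) * I ^ s := by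
    rw [← Ideal.unit_mul_mem_iff_mem _ hc]
    have : c * y ^ (s + 1) = - ∑ i, a i * eval (Fin.cons y a : Fin (ℓ + 1) → R) (z i) := by
      rw [eq_neg_iff_add_eq_zero, add_comm]
      simpa using h0
    rw [this]
    exact neg_mem (Ideal.sum_mem _ fun i _ =>
      Ideal.mul_mem_mul (Ideal.subset_span (Set.mem_range_self i)) (H.eval_mem (hz i)))
  refine H.not_le ?_
  calc I ^ (s + 1) = (Ideal.span (Set.range a) ⊔ Ideal.span {y}) ^ (s + 1) := by rw [← H.eq_sup]
    _ ≤ _ := Ideal.sup_span_singleton_pow_le H.span_range_le H.mem_left s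
    _ ≤ _ := sup_le le_rfl ((Ideal.span_singleton_le_iff_mem _).2 hy)

/-- After multiplication by `X₀` the pure power is `c * X₀ ^ (s + 2)`, which can be traded for `c`
times the monic relation. That term dies modulo `𝔪`, and the rest is a relation to which the
rewriting applies. -/
lemma exists_X_zero_mul_map_residue_eq (H : ColonSequence I a y s)
    {h : MvPolynomial (Fin (ℓ + 1)) R}
    (hh : h.IsHomogeneous (s + 1)) (h0 : eval (Fin.cons y a : Fin (ℓ + 1) → R) h = 0) :
    ∃ w : Fin ℓ → MvPolynomial (Fin (ℓ + 1)) R, (∀ i, (w i).IsHomogeneous (s + 1)) ∧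
      (∀ i, eval (Fin.cons y a : Fin (ℓ + 1) → R) (w i) = 0) ∧
      X 0 * h.map (residue R) = ∑ i : Fin ℓ, X i.succ * (w i).map (residue R) := by
  obtain ⟨z, c, hz, rfl⟩ := hh.exists_eq_sum_X_succ_mul_add
  have hc := H.mem_maximalIdeal_of_eval_eq_zero hz h0
  obtain ⟨v, hv, hg⟩ := H.exists_monicForm
  have hdec : X 0 * (∑ i, X i.succ * z i + C c * X 0 ^ (s + 1)) =
      ∑ i, X i.succ * (X 0 * z i + C c * v i) + C c * monicForm v (s + 2) := by
    have h1 : ∀ i : Fin ℓ, X i.succ * (X 0 * z i + C c * v i) =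
      X 0 * (X i.succ * z i) + C c * (X i.succ * v i) := fun i => by ring
    simp only [h1, Finset.sum_add_distrib, ← Finset.mul_sum, monicForm]
    ring
  obtain ⟨w, hw, hew, hsw⟩ := H.exists_relations 0 (fun i => X 0 * z i + C c * v i)
    (fun i => (add_comm 1 s ▸ (isHomogeneous_X _ _).mul (hz i)).add ((hv i).C_mul c)) (by
      have := congrArg (eval (Fin.cons y a : Fin (ℓ + 1) → R)) hdec
      rw [map_mul, h0, mul_zero, map_add, map_mul _ (C c), hg, mul_zero, add_zero] at this
      exact this.symm)
  refine ⟨w, hw, hew, ?_⟩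
  have := congrArg (MvPolynomial.map (residue R)) hdec
  rw [hsw, map_mul, map_X] at this
  rw [this, map_add, map_mul _ (C c), map_C, (residue_eq_zero_iff c).2 hc, C_0,
    zero_mul, add_zero, map_sum]
  simp only [map_mul, map_X]

/-- In `X₀ h = ∑ Xᵢ wᵢ` modulo `𝔪`, the left side has `X₀`-degree one more than `h`, while the
factors `Xᵢ` on the right contribute none. -/
lemma exists_degreeOf_lt (H : ColonSequence I a y s) {h : MvPolynomial (Fin (ℓ + 1)) R}
    (hh : h.IsHomogeneous (s + 1))
    (h0 : eval (Fin.cons y a : Fin (ℓ + 1) → R) h = 0) (hne : h.map (residue R) ≠ 0) :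
    ∃ h' : MvPolynomial (Fin (ℓ + 1)) R, h'.IsHomogeneous (s + 1) ∧
      eval (Fin.cons y a : Fin (ℓ + 1) → R) h' = 0 ∧ h'.map (residue R) ≠ 0 ∧
      degreeOf 0 (h.map (residue R)) < degreeOf 0 (h'.map (residue R)) := by
  obtain ⟨w, hw, hew, hmap⟩ := H.exists_X_zero_mul_map_residue_eq hh h0
  have hdeg := (degreeOf_mul_X_eq_degreeOf_add_one_iff 0 (h.map (residue R))).2 hne
  rw [mul_comm, hmap] at hdeg
  have hex : ∃ i, degreeOf 0 (h.map (residue R)) < degreeOf 0 ((w i).map (residue R)) := by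
    by_contra! hall
    have := (degreeOf_sum_le 0 Finset.univ
      (fun i : Fin ℓ => X i.succ * (w i).map (residue R))).trans (Finset.sup_le fun i _ => by
        rw [mul_comm, degreeOf_mul_X_of_ne _ (Fin.succ_ne_zero i).symm]
        exact hall i)
    lia
  obtain ⟨i, hi⟩ := hex
  refine ⟨w i, hw i, hew i, ?_, hi⟩
  rintro h
  rw [h, degreeOf_zero] at hi
  exact Nat.not_lt_zero _ hi

/-- Relations of degree at most `s + 1` have coefficients in the maximal ideal. -/
lemma map_residue_eq_zero (H : ColonSequence I a y s) {d : ℕ} (hd : d ≤ s + 1)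
    {h : MvPolynomial (Fin (ℓ + 1)) R}
    (hh : h.IsHomogeneous d) (h0 : eval (Fin.cons y a : Fin (ℓ + 1) → R) h = 0) :
    h.map (residue R) = 0 := by
  -- The `X₀`-degree of a form of degree `s + 1` is at most `s + 1`, so it cannot keep increasing;
  -- `n` bounds the increases still possible.
  have key : ∀ n, ∀ h : MvPolynomial (Fin (ℓ + 1)) R, h.IsHomogeneous (s + 1) →
      eval (Fin.cons y a : Fin (ℓ + 1) → R) h = 0 →
      s + 1 < degreeOf 0 (h.map (residue R)) + n → h.map (residue R) = 0 := by
    intro n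
    induction n with
    | zero =>
      intro h hh _ hlt
      have h1 := (degreeOf_le_totalDegree (h.map (residue R)) 0).trans
        (hh.map (residue R)).totalDegree_le
      lia
    | succ n ih =>
      intro h hh h0 hlt
      by_contra hne
      obtain ⟨h', hh', h0', hne', hlt'⟩ := H.exists_degreeOf_lt hh h0 hne
      exact hne' (ih h' hh' h0' (by lia))
  -- Relations of lower degree are brought to degree `s + 1` by a power of `X₀`, which can be
  -- cancelled over the residue field.
  have h1 := key (s + 2) (X 0 ^ (s + 1 - d) * h)
    (by simpa [Nat.sub_add_cancel hd] using
      (isHomogeneous_X_pow (R := R) (0 : Fin (ℓ + 1)) (s + 1 - d)).mul hh)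
    (by rw [map_mul, h0, mul_zero]) (by lia)
  rw [map_mul, map_pow, map_X] at h1
  exact (mul_eq_zero.1 h1).resolve_left (pow_ne_zero _ (X_ne_zero _))

/-- Modulo the maximal ideal, all relations are multiples of a single one. -/
lemma map_residue_mem_span (H : ColonSequence I a y s) {v : Fin ℓ → MvPolynomial (Fin (ℓ + 1)) R}
    (hv : ∀ i, (v i).IsHomogeneous (s + 1))
    (hg : eval (Fin.cons y a : Fin (ℓ + 1) → R) (monicForm v (s + 2)) = 0)
    {d : ℕ} {h : MvPolynomial (Fin (ℓ + 1)) R}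
    (hh : h.IsHomogeneous d) (h0 : eval (Fin.cons y a : Fin (ℓ + 1) → R) h = 0) :
    h.map (residue R) ∈ Ideal.span {(monicForm v (s + 2)).map (residue R)} := by
  rcases le_or_gt d (s + 1) with hd | hd
  · rw [H.map_residue_eq_zero hd hh h0]; exact zero_mem _
  obtain ⟨n, rfl⟩ := Nat.exists_eq_add_of_le hd
  clear hd
  have step : ∀ n, (∀ h : MvPolynomial (Fin (ℓ + 1)) R, h.IsHomogeneous (s + 1 + n) →
        eval (Fin.cons y a : Fin (ℓ + 1) → R) h = 0 →
        h.map (residue R) ∈ Ideal.span {(monicForm v (s + 2)).map (residue R)}) →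
      ∀ h : MvPolynomial (Fin (ℓ + 1)) R, h.IsHomogeneous (s + 1 + n + 1) →
        eval (Fin.cons y a : Fin (ℓ + 1) → R) h = 0 →
        h.map (residue R) ∈ Ideal.span {(monicForm v (s + 2)).map (residue R)} := by
    intro n ih h hh h0
    obtain ⟨z, c, hz, rfl⟩ := hh.exists_eq_sum_X_succ_mul_add
    -- The pure power of `X₀` is traded for a multiple of the monic form; the remaining relation is
    -- rewritten with relations of one degree less, to which `ih` applies.
    have hdec : ∑ i, X i.succ * z i + C c * X 0 ^ (s + 1 + n + 1) =
        ∑ i, X i.succ * (z i + C c * (X 0 ^ n * v i)) +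
          C c * X 0 ^ n * monicForm v (s + 2) := by
      have h1 : ∀ i : Fin ℓ, X i.succ * (z i + C c * (X 0 ^ n * v i)) =
        X i.succ * z i + C c * X 0 ^ n * (X i.succ * v i) := fun i => by ring
      simp only [h1, Finset.sum_add_distrib, ← Finset.mul_sum, monicForm]
      ring
    obtain ⟨w, hw, hew, hsw⟩ := H.exists_relations n (fun i => z i + C c * (X 0 ^ n * v i))
      (fun i => (hz i).add (IsHomogeneous.C_mul
        (add_comm n (s + 1) ▸ (isHomogeneous_X_pow _ _).mul (hv i)) c)) (by
        rw [hdec, map_add, map_mul _ (C c * X 0 ^ n), hg, mul_zero, add_zero] at h0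
        exact h0)
    rw [hdec, hsw, map_add, map_mul _ (C c * X 0 ^ n), map_sum]
    refine add_mem (Ideal.sum_mem _ fun i _ => ?_)
      (Ideal.mul_mem_left _ _ (Ideal.mem_span_singleton_self _))
    rw [map_mul]
    exact Ideal.mul_mem_left _ _ (ih _ (hw i) (hew i))
  have all : ∀ n, ∀ h : MvPolynomial (Fin (ℓ + 1)) R, h.IsHomogeneous (s + 1 + n) →
      eval (Fin.cons y a : Fin (ℓ + 1) → R) h = 0 →
      h.map (residue R) ∈ Ideal.span {(monicForm v (s + 2)).map (residue R)} := by
    intro n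
    induction n with
    | zero => exact fun h hh h0 => by rw [H.map_residue_eq_zero le_rfl hh h0]; exact zero_mem _
    | succ n ih => exact step n ih
  refine all (n + 1) h ?_ h0
  rwa [show s + 1 + (n + 1) = (s + 1).succ + n by lia]

end LocalRing

end ColonSequence

end Relations

lemma Ideal.pow_succ_eq_mul_of_le {A : Type*} [CommRing A] {I J : Ideal A} {s n : ℕ}
    (hJ : I ^ (s + 1) = J * I ^ s) (h : s ≤ n) :
    I ^ (n + 1) = J * I ^ n := by
  obtain ⟨m, rfl⟩ := Nat.exists_eq_add_of_le h
  rw [add_right_comm, pow_add, hJ, mul_assoc, ← pow_add]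

/-! ### Finite maps from polynomial rings. -/

section FiniteMaps

variable {k B ι : Type*} [Field k] [CommRing B] [Algebra k B]

/-- A criterion for a map from a polynomial ring to an algebra with finite dimensional pieces `G d`
to be finite. -/
lemma RingHom.finite_of_iSup_eq_top (φ : MvPolynomial ι k →ₐ[k] B) (G : ℕ → Submodule k B)
    (hfg : ∀ d, (G d).FG) (htop : ∀ z, z ∈ ⨆ d, G d) (s : ℕ)
    (hsucc : ∀ d, s ≤ d → G (d + 1) ≤
      Submodule.span k {z | ∃ q, ∃ v ∈ G d, φ q * v = z}) :
    φ.toRingHom.Finite := by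
  let : Algebra (MvPolynomial ι k) B := φ.toRingHom.toAlgebra
  have htower : IsScalarTower k (MvPolynomial ι k) B :=
    IsScalarTower.of_algebraMap_eq fun c => (φ.commutes c).symm
  -- From degree `s` on each piece generates the next, so the pieces of degrees `0, …, s` generate
  -- everything.
  let N : Submodule (MvPolynomial ι k) B :=
    ⨆ d ∈ Finset.range (s + 1), Submodule.span _ (G d : Set B)
  have hNfg : N.FG := by
    refine Submodule.fg_biSup _ _ fun d _ => ?_
    obtain ⟨t, ht⟩ := hfg d
    refine ⟨t, ?_⟩
    rw [← ht, Submodule.span_span_of_tower]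
  have hN : ∀ d, G d ≤ N.restrictScalars k := by
    have hsmall : ∀ d, d < s + 1 → G d ≤ N.restrictScalars k := fun d hd z hz =>
      Submodule.mem_iSup_of_mem d (Submodule.mem_iSup_of_mem (by simpa using hd)
        (Submodule.subset_span hz))
    intro d
    induction d with
    | zero => exact hsmall 0 (Nat.succ_pos s)
    | succ d ih =>
      by_cases hd : d + 1 < s + 1
      · exact hsmall _ hd
      · refine (hsucc d (by lia)).trans (Submodule.span_le.2 ?_)
        rintro _ ⟨q, v, hv, rfl⟩
        exact N.smul_mem q (ih hv)
  have hNtop : N = ⊤ := eq_top_iff.2 fun z _ => (iSup_le hN : ⨆ d, G d ≤ N.restrictScalars k)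
    (htop z)
  exact ⟨hNtop ▸ hNfg⟩

lemma ringKrullDim_le_card_of_finite [Finite ι] (φ : MvPolynomial ι k →ₐ[k] B)
    (h : φ.toRingHom.Finite) : ringKrullDim B ≤ Nat.card ι := by
  algebraize [φ.toRingHom]
  refine (ringKrullDim_le_of_isIntegral (MvPolynomial ι k) B).trans ?_
  rw [MvPolynomial.ringKrullDim_of_isNoetherianRing, ringKrullDim_eq_zero_of_field, zero_add]

lemma card_le_ringKrullDim_of_finite_of_injective [Finite ι] (φ : MvPolynomial ι k →ₐ[k] B)
    (h : φ.toRingHom.Finite) (hinj : Function.Injective φ) : Nat.card ι ≤ ringKrullDim B := by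
  algebraize [φ.toRingHom]
  refine le_trans ?_ (ringKrullDim_le_of_isIntegral_of_injective (MvPolynomial ι k) B hinj)
  rw [MvPolynomial.ringKrullDim_of_isNoetherianRing, ringKrullDim_eq_zero_of_field, zero_add]

end FiniteMaps

/-! ### Reductions and Noether normalization of the fiber ring. -/

section Spread

variable {R : Type u} [CommRing R] [IsLocalRing R] {I : Ideal R}

namespace SpecialFiberRing

lemma residue_smul (c : R) (z : SpecialFiberRing I) : residue R c • z = c • z :=
  algebraMap_smul (ResidueField R) c z

/-- The degree `d` part of the special fiber ring, as a vector space. -/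
noncomputable def homogPart (I : Ideal R) (d : ℕ) :
    Submodule (ResidueField R) (SpecialFiberRing I) where
  carrier := Set.range (homogClass I d)
  add_mem' := by rintro _ _ ⟨v, rfl⟩ ⟨w, rfl⟩; exact ⟨v + w, map_add _ _ _⟩
  zero_mem' := ⟨0, map_zero _⟩
  smul_mem' := by
    rintro c _ ⟨v, rfl⟩
    obtain ⟨c, rfl⟩ := residue_surjective c
    exact ⟨c • v, by rw [residue_smul, map_smul]⟩

lemma homogClass_mem_homogPart (d : ℕ) (w : ↥(I ^ d)) : homogClass I d w ∈ homogPart I d :=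
  ⟨w, rfl⟩

lemma homogPart_fg [IsNoetherianRing R] (d : ℕ) : (homogPart I d).FG := by
  classical
  obtain ⟨t, ht⟩ := IsNoetherian.noetherian (⊤ : Submodule R ↥(I ^ d))
  refine ⟨t.image (homogClass I d), le_antisymm (Submodule.span_le.2 ?_) ?_⟩
  · rw [Finset.coe_image]; exact Set.image_subset_range _ _
  · rintro _ ⟨w, rfl⟩
    have hw : w ∈ Submodule.span R (t : Set ↥(I ^ d)) := ht ▸ Submodule.mem_top
    induction hw using Submodule.span_induction with
    | mem w hw => exact Submodule.subset_span (by
        rw [Finset.coe_image]; exact Set.mem_image_of_mem _ hw)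
    | zero => rw [map_zero]; exact zero_mem _
    | add v w _ _ hv hw => rw [map_add]; exact add_mem hv hw
    | smul c w _ hw =>
      rw [map_smul, ← residue_smul]
      exact Submodule.smul_mem _ _ hw

lemma mem_iSup_homogPart (z : SpecialFiberRing I) : z ∈ ⨆ d, homogPart I d := by
  obtain ⟨p, rfl⟩ := Ideal.Quotient.mk_surjective z
  rw [eq_sum_homogClass]
  exact Submodule.sum_mem _ fun d _ =>
    Submodule.mem_iSup_of_mem d (homogClass_mem_homogPart d _)

/-- Degree one elements spanning the initial forms of a reduction are the images of the variables
under a finite map. -/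
theorem finite_aeval_of_reduction [IsNoetherianRing R] {ι : Type*} (e : ι → SpecialFiberRing I)
    {J : Ideal R} (hJI : J ≤ I) {s : ℕ} (hJ : I ^ (s + 1) = J * I ^ s)
    (he : ∀ w : I, (w : R) ∈ J → ofIdeal I w ∈ Submodule.span (ResidueField R) (Set.range e)) :
    RingHom.Finite (A := MvPolynomial ι (ResidueField R)) (B := SpecialFiberRing I)
      (MvPolynomial.aeval e : MvPolynomial ι (ResidueField R) →ₐ[ResidueField R]
        SpecialFiberRing I).toRingHom := by
  refine RingHom.finite_of_iSup_eq_top _ (homogPart I) homogPart_fg mem_iSup_homogPart s ?_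
  rintro d hd _ ⟨w, rfl⟩
  let φ : MvPolynomial ι (ResidueField R) →ₐ[ResidueField R] SpecialFiberRing I :=
    MvPolynomial.aeval e
  have hrange : ∀ w : I, (w : R) ∈ J → ∃ q : MvPolynomial ι (ResidueField R),
      φ q = ofIdeal I w := by
    intro w hw
    have : Submodule.span (ResidueField R) (Set.range e) ≤ LinearMap.range φ.toLinearMap :=
      Submodule.span_le.2 (by rintro _ ⟨i, rfl⟩; exact ⟨MvPolynomial.X i, by simp [φ]⟩)
    exact this (he w hw)
  let T : Submodule (ResidueField R) (SpecialFiberRing I) :=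
    Submodule.span _ {z | ∃ q, ∃ v ∈ homogPart I d, φ q * v = z}
  have hle : J * I ^ d ≤ Submodule.map (Submodule.subtype (I ^ (d + 1)))
      ((T.restrictScalars R).comap (homogClass I (d + 1))) := by
    refine Submodule.mul_le.2 fun b hb v hv =>
      ⟨⟨b * v, by rw [pow_succ']; exact Ideal.mul_mem_mul (hJI hb) hv⟩, ?_, rfl⟩
    obtain ⟨q, hq⟩ := hrange ⟨b, hJI hb⟩ hb
    exact Submodule.subset_span ⟨q, _, homogClass_mem_homogPart d ⟨v, hv⟩, by
      rw [hq]; exact ofIdeal_mul_homogClass _ _⟩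
  rw [← Ideal.pow_succ_eq_mul_of_le hJ hd] at hle
  obtain ⟨v, hv, hvw⟩ := hle w.2
  rw [show w = v from Subtype.ext hvw.symm]
  exact hv

theorem analyticSpread_le_of_reduction [IsNoetherianRing R] {ι : Type*} [Finite ι]
    (e : ι → SpecialFiberRing I)
    {J : Ideal R} (hJI : J ≤ I) {s : ℕ} (hJ : I ^ (s + 1) = J * I ^ s)
    (he : ∀ w : I, (w : R) ∈ J → ofIdeal I w ∈ Submodule.span (ResidueField R) (Set.range e)) :
    analyticSpread I ≤ Nat.card ι :=
  ringKrullDim_le_card_of_finite _ (finite_aeval_of_reduction e hJI hJ he)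

theorem card_le_analyticSpread_of_injective [IsNoetherianRing R] {ι : Type*} [Finite ι]
    (e : ι → SpecialFiberRing I)
    {J : Ideal R} (hJI : J ≤ I) {s : ℕ} (hJ : I ^ (s + 1) = J * I ^ s)
    (he : ∀ w : I, (w : R) ∈ J → ofIdeal I w ∈ Submodule.span (ResidueField R) (Set.range e))
    (hinj : Function.Injective (MvPolynomial.aeval e : MvPolynomial ι (ResidueField R)
      →ₐ[ResidueField R] SpecialFiberRing I)) :
    Nat.card ι ≤ analyticSpread I :=
  card_le_ringKrullDim_of_finite_of_injective _ (finite_aeval_of_reduction e hJI hJ he) hinj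

/-- The image of `J` in the degree one part of the special fiber ring, as a vector space. -/
noncomputable def initialSpace (I J : Ideal R) :
    Submodule (ResidueField R) (SpecialFiberRing I) :=
  Submodule.span _ {z | ∃ w : I, (w : R) ∈ J ∧ ofIdeal I w = z}

lemma initialSpace_mono {J J' : Ideal R} (h : J ≤ J') : initialSpace I J ≤ initialSpace I J' :=
  Submodule.span_mono fun _ ⟨w, hw, e⟩ => ⟨w, h hw, e⟩

lemma ofIdeal_smul (c : R) (w : I) : ofIdeal I (c • w) = residue R c • ofIdeal I w := by
  rw [residue_smul]; exact (ofIdealₗ I).map_smul c w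

/-- The initial space of an ideal generated by `b` is spanned by the classes of `b`. -/
lemma initialSpace_span {ι : Type*} [Finite ι] (b : ι → I) :
    initialSpace I (Ideal.span (Set.range fun i => (b i : R))) =
      Submodule.span (ResidueField R) (Set.range fun i => ofIdeal I (b i)) := by
  have := Fintype.ofFinite ι
  refine le_antisymm (Submodule.span_le.2 ?_) (Submodule.span_le.2 ?_)
  · rintro _ ⟨w, hw, rfl⟩
    obtain ⟨c, hc⟩ := Ideal.mem_span_range_iff_exists_fun.1 hw
    have hw' : w = ∑ i, c i • b i := Subtype.ext (by simpa using hc.symm)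
    rw [hw', ← ofIdealₗ_apply, map_sum]
    refine sum_mem fun i _ => ?_
    rw [ofIdealₗ_apply, ofIdeal_smul]
    exact Submodule.smul_mem _ _ (Submodule.subset_span ⟨i, rfl⟩)
  · rintro _ ⟨i, rfl⟩
    exact Submodule.subset_span ⟨b i, Ideal.subset_span ⟨i, rfl⟩, rfl⟩

/-- An element of the initial space of `J` is the class of an element of `J`. -/
lemma exists_of_mem_initialSpace {J : Ideal R} {z : SpecialFiberRing I}
    (hz : z ∈ initialSpace I J) : ∃ w : I, (w : R) ∈ J ∧ ofIdeal I w = z := by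
  induction hz using Submodule.span_induction with
  | mem z hz => exact hz
  | zero => exact ⟨0, zero_mem _, (ofIdealₗ I).map_zero⟩
  | add z z' _ _ h h' =>
    obtain ⟨w, hw, rfl⟩ := h
    obtain ⟨w', hw', rfl⟩ := h'
    exact ⟨w + w', add_mem hw hw', (ofIdealₗ I).map_add w w'⟩
  | smul c z _ h =>
    obtain ⟨w, hw, rfl⟩ := h
    obtain ⟨c, rfl⟩ := residue_surjective c
    exact ⟨c • w, J.mul_mem_left c hw, ofIdeal_smul c w⟩

lemma mem_sup_of_ofIdeal_mem_initialSpace {J : Ideal R} {w : I}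
    (hw : ofIdeal I w ∈ initialSpace I J) : (w : R) ∈ J ⊔ maximalIdeal R * I := by
  obtain ⟨v, hv, hvw⟩ := exists_of_mem_initialSpace hw
  have : ofIdeal I (w - v) = 0 := by
    rw [← ofIdealₗ_apply, map_sub, ofIdealₗ_apply, ofIdealₗ_apply, hvw, sub_self]
  rw [ofIdeal_eq_zero_iff] at this
  rw [show (w : R) = v + (w - v : I) by simp]
  exact Submodule.add_mem_sup hv this

end SpecialFiberRing

end Spread

/-! ### Minimal reductions have as many generators as the analytic spread. -/

section Reductions

/-- Values of a form along a line through the origin, modulo the remaining directions. -/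
lemma MvPolynomial.IsHomogeneous.pow_mem_of_map_eq_zero {k B ι : Type*} [Field k] [CommRing B]
    [Algebra k B] {P : MvPolynomial ι k} {d : ℕ} (hP : P.IsHomogeneous d)
    (φ : MvPolynomial ι k →ₐ[k] B) (hφ : φ P = 0) {c : ι → k} (hc : MvPolynomial.eval c P ≠ 0)
    (i : ι) (𝔟 : Ideal B)
    (h𝔟 : ∀ j, φ (MvPolynomial.C (c i) * MvPolynomial.X j - MvPolynomial.C (c j) *
      MvPolynomial.X i) ∈ 𝔟) : φ (MvPolynomial.X i) ^ d ∈ 𝔟 := by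
  obtain ⟨x, rfl⟩ : ∃ x, MvPolynomial.aeval x = φ := ⟨_, MvPolynomial.aeval_unique φ |>.symm⟩
  have hx := hφ
  rw [MvPolynomial.aeval_X]
  simp only [map_sub, map_mul, MvPolynomial.aeval_C, MvPolynomial.aeval_X] at h𝔟
  have hscale : ∀ (t : B) (u : ι → B), MvPolynomial.aeval (fun j => t * u j) P =
      t ^ d * MvPolynomial.aeval u P := by
    intro t u
    rw [MvPolynomial.aeval_def, MvPolynomial.aeval_def, MvPolynomial.eval₂_eq,
      MvPolynomial.eval₂_eq, Finset.mul_sum]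
    refine Finset.sum_congr rfl fun m hm => ?_
    have hd : m.degree = d := by
      rw [← hP (MvPolynomial.mem_support_iff.1 hm), Finsupp.degree_eq_weight_one]; rfl
    have hd' : ∑ i ∈ m.support, m i = d := hd
    simp only [mul_pow, Finset.prod_mul_distrib, Finset.prod_pow_eq_pow_sum, hd']
    ring
  have hmk : ∀ u v : ι → B, (∀ j, u j - v j ∈ 𝔟) →
      MvPolynomial.aeval u P - MvPolynomial.aeval v P ∈ 𝔟 := by
    intro u v huv
    rw [← Ideal.Quotient.mk_eq_mk_iff_sub_mem]
    change Ideal.Quotient.mkₐ k 𝔟 _ = Ideal.Quotient.mkₐ k 𝔟 _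
    rw [← AlgHom.comp_apply, ← AlgHom.comp_apply, MvPolynomial.comp_aeval, MvPolynomial.comp_aeval]
    congr 2
    ext j
    exact Ideal.Quotient.mk_eq_mk_iff_sub_mem _ _ |>.2 (huv j)
  -- Modulo `𝔟` the vectors `c i • x` and `x i • c` agree, so homogeneity turns `P(x) = 0` into `x i
  -- ^ d * P(c) = 0`, and `P(c)` is a unit.
  have h1 := hmk (fun j => algebraMap k B (c i) * x j) (fun j => x i * algebraMap k B (c j))
    (fun j => by simpa [mul_comm] using h𝔟 j)
  rw [hscale, hscale, hx, mul_zero, zero_sub, neg_mem_iff] at h1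
  have h2 : MvPolynomial.aeval (fun j => algebraMap k B (c j)) P =
      algebraMap k B (MvPolynomial.eval c P) := by
    have := MvPolynomial.aeval_algebraMap_apply B c P
    exact this.trans (congrArg _ (DFunLike.congr_fun (MvPolynomial.coe_aeval_eq_eval c) P))
  rw [h2] at h1
  have hu : IsUnit (algebraMap k B (MvPolynomial.eval c P)) := (IsUnit.mk0 _ hc).map _
  exact (Ideal.mul_unit_mem_iff_mem _ hu).1 h1

lemma Submodule.exists_fin_span_eq {k V : Type*} [Field k] [AddCommGroup V] [Module k V]
    (W : Submodule k V) [FiniteDimensional k W] :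
    ∃ e : Fin (Module.finrank k W) → V, Submodule.span k (Set.range e) = W := by
  let B := Module.finBasis k W
  refine ⟨fun i => B i, ?_⟩
  have := congrArg (Submodule.map W.subtype) B.span_eq
  rw [Submodule.map_span, ← Set.range_comp, Submodule.map_top, Submodule.range_subtype] at this
  exact this

lemma IsReductionOf.le {A : Type u} [CommRing A] {J I : Ideal A} (h : IsReductionOf J I) : J ≤ I :=
  h.1

lemma MvPolynomial.map_homogeneousComponent {A B ι : Type*} [CommSemiring A] [CommSemiring B]
    (f : A →+* B) (d : ℕ) (h : MvPolynomial ι A) :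
    (homogeneousComponent d h).map f = homogeneousComponent d (h.map f) := by
  ext m
  simp only [coeff_map, coeff_homogeneousComponent]
  split_ifs <;> simp

variable {R : Type u} [CommRing R] [IsLocalRing R] {I : Ideal R}

lemma Ideal.le_of_le_sup_maximalIdeal_mul [IsNoetherianRing R] {J K : Ideal R}
    (h : J ≤ K ⊔ maximalIdeal R * J) : J ≤ K :=
  Submodule.le_of_le_smul_of_le_jacobson_bot (IsNoetherian.noetherian J)
    (maximalIdeal_le_jacobson ⊥) h

lemma Ideal.pow_add_eq_pow_mul {A : Type*} [CommRing A] {I J : Ideal A} {s : ℕ}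
    (hJ : I ^ (s + 1) = J * I ^ s) (d : ℕ) : I ^ (s + d) = J ^ d * I ^ s := by
  induction d with
  | zero => simp
  | succ d ih =>
    rw [← add_assoc, Ideal.pow_succ_eq_mul_of_le hJ (Nat.le_add_right s d), ih, pow_succ',
      mul_assoc]

namespace SpecialFiberRing

lemma homogClass_pow (x : I) (d : ℕ) :
    ofIdeal I x ^ d = homogClass I d ⟨(x : R) ^ d, Ideal.pow_mem_pow x.2 d⟩ := by
  change (Ideal.Quotient.mk _ _) ^ d = Ideal.Quotient.mk _ _
  rw [← map_pow]
  congr 1; ext1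
  simp [Polynomial.monomial_pow]

/-- A reduction with more generators than the analytic spread satisfies a nontrivial form. -/
lemma exists_form_of_analyticSpread_lt [IsNoetherianRing R] {m s : ℕ}
    (hm : analyticSpread I < (m : ℕ)) (b : Fin m → I)
    (hb : I ^ (s + 1) = Ideal.span (Set.range fun i => (b i : R)) * I ^ s) :
    ∃ (d : ℕ) (P : MvPolynomial (Fin m) (ResidueField R)), P.IsHomogeneous (d + 1) ∧ P ≠ 0 ∧
      fiberEval b P = 0 := by
  set J := Ideal.span (Set.range fun i => (b i : R)) with hJdef
  have hJI : J ≤ I := Ideal.span_le.2 (by rintro _ ⟨i, rfl⟩; exact (b i).2)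
  have hninj : ¬ Function.Injective (fiberEval b) := by
    intro hinj
    refine not_le_of_gt hm ?_
    have := card_le_analyticSpread_of_injective (fun i => ofIdeal I (b i)) hJI hb
      (fun w hw => by rw [← initialSpace_span]; exact Submodule.subset_span ⟨w, hw, rfl⟩) hinj
    simpa using this
  obtain ⟨f, hf, hf0⟩ : ∃ f, fiberEval b f = 0 ∧ f ≠ 0 := by
    by_contra! h
    exact hninj ((injective_iff_map_eq_zero _).2 h)
  obtain ⟨h, rfl⟩ := MvPolynomial.map_surjective _ residue_surjective f
  obtain ⟨d, hd⟩ : ∃ d, MvPolynomial.homogeneousComponent d (h.map (residue R)) ≠ 0 := by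
    by_contra! hall
    refine hf0 ?_
    rw [← MvPolynomial.sum_homogeneousComponent (h.map (residue R))]
    exact Finset.sum_eq_zero fun i _ => hall i
  rw [← MvPolynomial.map_homogeneousComponent] at hd
  have hev := eval_homogeneousComponent_mem b hf d
  have hp : (MvPolynomial.homogeneousComponent d h).IsHomogeneous d :=
    MvPolynomial.homogeneousComponent_isHomogeneous d h
  generalize MvPolynomial.homogeneousComponent d h = p at hd hev hp
  have hPz := fiberEval_map_eq_zero b hp hev
  have hP := hp.map (residue R)
  obtain _ | d := d
  · exfalso
    rw [← MvPolynomial.totalDegree_zero_iff_isHomogeneous,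
      MvPolynomial.totalDegree_eq_zero_iff_eq_C] at hp
    rw [hp] at hev hd
    rw [MvPolynomial.eval_C, pow_zero, mul_one] at hev
    rw [MvPolynomial.map_C, (residue_eq_zero_iff _).2 hev, MvPolynomial.C_0] at hd
    exact hd rfl
  exact ⟨d, _, hP, hd, hPz⟩

/-- Replacing generators `b` of a reduction by the differences `cᵢ bⱼ - cⱼ bᵢ` for `j ≠ i`. -/
lemma exists_reduction_of_pow_mem [IsNoetherianRing R] {m s d : ℕ} (b : Fin (m + 1) → I)
    (hb : I ^ (s + 1) = Ideal.span (Set.range fun i => (b i : R)) * I ^ s)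
    (c : Fin (m + 1) → R) (i : Fin (m + 1)) (hc : IsUnit (c i)) (b' : Fin m → I)
    (hb' : ∀ t, b' t = c i • b (i.succAbove t) - c (i.succAbove t) • b i)
    (hbi : (b i : R) ^ (d + 1) ∈ Ideal.span (Set.range fun t => (b' t : R)) * I ^ d ⊔
      maximalIdeal R * I ^ (d + 1)) :
    Ideal.span (Set.range fun i => (b' i : R)) ≤ Ideal.span (Set.range fun i => (b i : R)) ∧
      ∃ t, I ^ (t + 1) = Ideal.span (Set.range fun i => (b' i : R)) * I ^ t := by
  have hbJ : ∀ j, (b j : R) ∈ Ideal.span (Set.range fun i => (b i : R)) :=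
    fun j => Ideal.subset_span (Set.mem_range_self j)
  have hJI : Ideal.span (Set.range fun i => (b i : R)) ≤ I :=
    Ideal.span_le.2 (by rintro _ ⟨i, rfl⟩; exact (b i).2)
  have hb'J : ∀ t, (b' t : R) ∈ Ideal.span (Set.range fun i => (b' i : R)) :=
    fun t => Ideal.subset_span (Set.mem_range_self t)
  have hbc : ∀ t, (b' t : R) = c i * b (i.succAbove t) - c (i.succAbove t) * b i :=
    fun t => congrArg Subtype.val (hb' t)
  generalize hJ : Ideal.span (Set.range fun i => (b i : R)) = J at *
  have hJ'J : Ideal.span (Set.range fun i => (b' i : R)) ≤ J := Ideal.span_le.2 (by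
    rintro _ ⟨t, rfl⟩
    change (b' t : R) ∈ J
    rw [hbc]
    exact sub_mem (J.mul_mem_left _ (hbJ _)) (J.mul_mem_left _ (hbJ _)))
  generalize Ideal.span (Set.range fun i => (b' i : R)) = J' at *
  have hJle : J ≤ J' ⊔ Ideal.span {(b i : R)} := by
    rw [← hJ]
    refine Ideal.span_le.2 ?_
    rintro _ ⟨j, rfl⟩
    rcases Fin.eq_self_or_eq_succAbove i j with rfl | ⟨t, rfl⟩
    · exact Ideal.mem_sup_right (Ideal.mem_span_singleton_self _)
    · refine (Ideal.unit_mul_mem_iff_mem _ hc).1 ?_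
      change c i * (b (i.succAbove t) : R) ∈ _
      rw [← sub_add_cancel (c i * (b (i.succAbove t) : R)) (c (i.succAbove t) * b i), ← hbc]
      exact add_mem (Ideal.mem_sup_left (hb'J t))
        (Ideal.mul_mem_left _ _ (Ideal.mem_sup_right (Ideal.mem_span_singleton_self _)))
  have hJpow : J ^ (d + 1) ≤ J' * I ^ d ⊔ maximalIdeal R * I ^ (d + 1) :=
    calc J ^ (d + 1) ≤ (J' ⊔ Ideal.span {(b i : R)}) ^ (d + 1) := Ideal.pow_right_mono hJle _
      _ ≤ J' * I ^ d ⊔ Ideal.span {(b i : R) ^ (d + 1)} :=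
        Ideal.sup_span_singleton_pow_le (hJ'J.trans hJI) (b i).2 d
      _ ≤ _ := sup_le le_sup_left ((Ideal.span_singleton_le_iff_mem _).2 hbi)
  refine ⟨hJ'J, s + d, le_antisymm (Ideal.le_of_le_sup_maximalIdeal_mul ?_) ?_⟩
  · rw [add_assoc]
    nth_rw 1 [Ideal.pow_add_eq_pow_mul hb]
    refine (Ideal.mul_mono_left hJpow).trans ?_
    rw [Ideal.sup_mul, mul_assoc, mul_assoc, ← pow_add, ← pow_add, add_comm d, add_comm (d + 1)]
  · rw [pow_succ']
    exact Ideal.mul_mono_left (hJ'J.trans hJI)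

lemma ofIdeal_sub (v w : I) : ofIdeal I (v - w) = ofIdeal I v - ofIdeal I w :=
  (ofIdealₗ I).map_sub v w

/-- Over an infinite residue field, a reduction with more generators than the analytic spread
contains a reduction with one generator less. -/
theorem exists_reduction_of_analyticSpread_lt [IsNoetherianRing R] [Infinite (ResidueField R)]
    {m s : ℕ} (hm : analyticSpread I < (m + 1 : ℕ)) (b : Fin (m + 1) → I)
    (hb : I ^ (s + 1) = Ideal.span (Set.range fun i => (b i : R)) * I ^ s) :
    ∃ b' : Fin m → I, Ideal.span (Set.range fun i => (b' i : R)) ≤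
        Ideal.span (Set.range fun i => (b i : R)) ∧
      ∃ t, I ^ (t + 1) = Ideal.span (Set.range fun i => (b' i : R)) * I ^ t := by
  obtain ⟨d, P, hP, hP0, hPz⟩ := exists_form_of_analyticSpread_lt hm b hb
  obtain ⟨c, hc⟩ : ∃ c, MvPolynomial.eval c P ≠ 0 := by
    by_contra! hall
    exact hP0 (hP.eq_zero_of_forall_eval_eq_zero hall)
  obtain ⟨i, hi⟩ : ∃ i, c i ≠ 0 := by
    by_contra! hall
    refine hc ?_
    rw [show c = 0 from funext hall, MvPolynomial.eval_zero, MvPolynomial.constantCoeff_eq]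
    exact hP.coeff_eq_zero (by simp)
  choose ĉ hĉ using fun j => residue_surjective (c j)
  have hunit : IsUnit (ĉ i) := by
    by_contra hn
    exact hi (by rw [← hĉ, residue_eq_zero_iff]; exact hn)
  obtain ⟨b', hb'⟩ : ∃ b' : Fin m → I, ∀ t,
      b' t = ĉ i • b (i.succAbove t) - ĉ (i.succAbove t) • b i := ⟨_, fun _ => rfl⟩
  have hmem : ∀ j, fiberEval b (MvPolynomial.C (c i) * MvPolynomial.X j -
      MvPolynomial.C (c j) * MvPolynomial.X i) ∈
      Ideal.span (Set.range fun t => ofIdeal I (b' t)) := by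
    intro j
    have hval : fiberEval b (MvPolynomial.C (c i) * MvPolynomial.X j -
        MvPolynomial.C (c j) * MvPolynomial.X i) = ofIdeal I (ĉ i • b j - ĉ j • b i) := by
      rw [ofIdeal_sub, ofIdeal_smul, ofIdeal_smul, hĉ, hĉ, ← fiberEval_X, ← fiberEval_X,
        ← MvPolynomial.smul_eq_C_mul, ← MvPolynomial.smul_eq_C_mul, map_sub]
      exact congrArg₂ _ ((fiberEval b).toLinearMap.map_smul _ _)
        ((fiberEval b).toLinearMap.map_smul _ _)
    rw [hval]
    rcases Fin.eq_self_or_eq_succAbove i j with rfl | ⟨t, rfl⟩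
    · rw [sub_self]
      rw [← ofIdealₗ_apply, (ofIdealₗ I).map_zero]
      exact Submodule.zero_mem _
    · rw [← hb']
      exact Ideal.subset_span (Set.mem_range_self t)
  have hpow := hP.pow_mem_of_map_eq_zero (B := SpecialFiberRing I) (fiberEval b) hPz hc i _ hmem
  rw [fiberEval_X] at hpow
  rw [homogClass_pow] at hpow
  exact ⟨b', exists_reduction_of_pow_mem b hb ĉ i hunit b' hb'
    (mem_of_homogClass_mem_span b' _ hpow)⟩

/-- Over an infinite residue field, every reduction contains a reduction generated by as many
elements as the analytic spread. -/
theorem exists_reduction_le [IsNoetherianRing R] [Infinite (ResidueField R)] {ℓ : ℕ}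
    (hℓ : analyticSpread I = ℓ) {J : Ideal R} (hJ : IsReductionOf J I) :
    ∃ b : Fin ℓ → I, Ideal.span (Set.range fun i => (b i : R)) ≤ J ∧
      ∃ t, I ^ (t + 1) = Ideal.span (Set.range fun i => (b i : R)) * I ^ t := by
  have key : ∀ n, ∀ b : Fin (ℓ + n) → I,
      (∃ t, I ^ (t + 1) = Ideal.span (Set.range fun i => (b i : R)) * I ^ t) →
      ∃ b' : Fin ℓ → I, Ideal.span (Set.range fun i => (b' i : R)) ≤
        Ideal.span (Set.range fun i => (b i : R)) ∧
        ∃ t, I ^ (t + 1) = Ideal.span (Set.range fun i => (b' i : R)) * I ^ t := by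
    intro n
    induction n with
    | zero => exact fun b hb => ⟨b, le_rfl, hb⟩
    | succ n ih =>
      rintro b ⟨s, hb⟩
      obtain ⟨b', hle, hb'⟩ := exists_reduction_of_analyticSpread_lt (m := ℓ + n)
        (by rw [hℓ]; exact_mod_cast Nat.lt_succ_of_le (Nat.le_add_right ℓ n)) b hb
      obtain ⟨b'', hle', hb''⟩ := ih b' hb'
      exact ⟨b'', hle'.trans hle, hb''⟩
  obtain ⟨hJI, s, hs⟩ := hJ
  obtain ⟨n, g, hg⟩ := Submodule.fg_iff_exists_fin_generating_family.1 (IsNoetherian.noetherian J)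
  have hgJ : ∀ i, g i ∈ J := fun i => hg ▸ Submodule.subset_span ⟨i, rfl⟩
  -- Padding with `ℓ` zeros guarantees at least `ℓ` generators, so dropping them one at a time ends
  -- exactly at `ℓ`.
  let b : Fin (ℓ + n) → I := Fin.append (fun _ => 0) fun i => ⟨g i, hJI (hgJ i)⟩
  have hb : Ideal.span (Set.range fun i => (b i : R)) = J := by
    refine le_antisymm (Ideal.span_le.2 ?_) ?_
    · rintro _ ⟨i, rfl⟩
      refine Fin.addCases (fun i => ?_) (fun i => ?_) i
      · simp [b]
      · simpa [b] using hgJ i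
    · rw [← hg]
      refine Ideal.span_mono ?_
      rintro _ ⟨i, rfl⟩
      exact ⟨Fin.natAdd ℓ i, by simp [b]⟩
  obtain ⟨b', hle, hb'⟩ := key n b ⟨s, by rw [hb, hs]⟩
  exact ⟨b', hb ▸ hle, hb'⟩

lemma initialSpace_le_homogPart (J : Ideal R) : initialSpace I J ≤ homogPart I 1 := by
  refine Submodule.span_le.2 ?_
  rintro _ ⟨w, -, rfl⟩
  exact homogClass_mem_homogPart 1 ⟨(w : R), by rw [pow_one]; exact w.2⟩

lemma finiteDimensional_initialSpace [IsNoetherianRing R] (J : Ideal R) :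
    FiniteDimensional (ResidueField R) (initialSpace I J) := by
  have : FiniteDimensional (ResidueField R) (homogPart I 1) :=
    Module.Finite.iff_fg.2 (homogPart_fg 1)
  exact Submodule.finiteDimensional_of_le (initialSpace_le_homogPart J)

/-- The initial space of a reduction is at least as large as the analytic spread. -/
lemma le_finrank_initialSpace [IsNoetherianRing R] {ℓ : ℕ} (hℓ : analyticSpread I = ℓ)
    {J : Ideal R} (hJ : IsReductionOf J I) :
    ℓ ≤ Module.finrank (ResidueField R) (initialSpace I J) := by
  have := finiteDimensional_initialSpace (I := I) J
  obtain ⟨hJI, s, hs⟩ := hJ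
  obtain ⟨e, he⟩ := Submodule.exists_fin_span_eq (initialSpace I J)
  have h1 := analyticSpread_le_of_reduction e hJI hs
    (fun w hw => by rw [he]; exact Submodule.subset_span ⟨w, hw, rfl⟩)
  rw [hℓ, Nat.card_fin] at h1
  exact_mod_cast h1

/-- Generators of a reduction, as many as the analytic spread, have independent initial forms. -/
lemma linearIndependent_ofIdeal [IsNoetherianRing R] {ℓ : ℕ} (hℓ : analyticSpread I = ℓ)
    {b : Fin ℓ → I} (hb : IsReductionOf (Ideal.span (Set.range fun i => (b i : R))) I) :
    LinearIndependent (ResidueField R) fun i => ofIdeal I (b i) := by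
  rw [linearIndependent_iff_card_le_finrank_span, Fintype.card_fin, Set.finrank,
    ← initialSpace_span]
  exact le_finrank_initialSpace hℓ hb

/-- A smaller reduction `J'` still has initial space of dimension at least `ℓ`, hence the same one
as `(b)`. So elements of `(b)` agree with elements of `J'` up to `(b) ∩ 𝔪 I`, which is `𝔪 (b)` by
independence of the initial forms; Nakayama concludes. -/
theorem isMinimalReductionOf_span [IsNoetherianRing R] {ℓ : ℕ} (hℓ : analyticSpread I = ℓ)
    {b : Fin ℓ → I} (hb : IsReductionOf (Ideal.span (Set.range fun i => (b i : R))) I) :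
    IsMinimalReductionOf (Ideal.span (Set.range fun i => (b i : R))) I := by
  refine ⟨hb, fun J' hJ' hle => Ideal.le_of_le_sup_maximalIdeal_mul ?_⟩
  have := finiteDimensional_initialSpace (I := I) (Ideal.span (Set.range fun i => (b i : R)))
  have hfin : Module.finrank (ResidueField R)
      (initialSpace I (Ideal.span (Set.range fun i => (b i : R)))) ≤ ℓ := by
    rw [initialSpace_span]
    have := finrank_range_le_card (R := ResidueField R) fun i => ofIdeal I (b i)
    rwa [Fintype.card_fin] at this
  have heq := Submodule.eq_of_le_of_finrank_le (initialSpace_mono (I := I) hle)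
    (hfin.trans (le_finrank_initialSpace hℓ hJ'))
  have hli := linearIndependent_ofIdeal hℓ hb
  intro w hw
  obtain ⟨v, hv, hvw⟩ := exists_of_mem_initialSpace (J := J') (z := ofIdeal I ⟨w, hb.le hw⟩)
    (by rw [heq]; exact Submodule.subset_span ⟨_, hw, rfl⟩)
  rw [← add_sub_cancel (v : R) w]
  refine Submodule.add_mem_sup hv ?_
  obtain ⟨c, hc⟩ := Ideal.mem_span_range_iff_exists_fun.1 (sub_mem hw (hle hv))
  have hsum : ∑ i, residue R (c i) • ofIdeal I (b i) = 0 := by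
    have h1 : ∑ i, c i • b i = ⟨w, hb.le hw⟩ - v := Subtype.ext (by simpa using hc)
    have h2 := congrArg (ofIdealₗ I) h1
    rw [map_sub, map_sum, ofIdealₗ_apply, ofIdealₗ_apply, hvw, sub_self] at h2
    rw [← h2]
    exact Finset.sum_congr rfl fun i _ => (ofIdeal_smul _ _).symm
  rw [← hc]
  refine Ideal.sum_mem _ fun i _ => Ideal.mul_mem_mul ?_ (Ideal.subset_span ⟨i, rfl⟩)
  rw [← residue_eq_zero_iff]
  exact Fintype.linearIndependent_iff.1 hli _ hsum i

/-- The reduction number is attained by a reduction generated by as many elements as the analytic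
spread. -/
theorem exists_span_pow_eq_reductionNumber [IsNoetherianRing R] [Infinite (ResidueField R)] {ℓ : ℕ}
    (hℓ : analyticSpread I = ℓ) :
    ∃ b : Fin ℓ → I, I ^ (reductionNumber I + 1) =
      Ideal.span (Set.range fun i => (b i : R)) * I ^ reductionNumber I := by
  have hII : IsReductionOf I I := ⟨le_rfl, 0, by simp⟩
  -- The infimum of the empty set is `0`, so nonemptiness is what makes the reduction number
  -- attained.
  have hne : {s : ℕ | ∃ J : Ideal R, IsMinimalReductionOf J I ∧
    s = reductionNumberWrt J I}.Nonempty := by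
    obtain ⟨b, hle, hb⟩ := exists_reduction_le hℓ hII
    exact ⟨_, _, isMinimalReductionOf_span hℓ ⟨hle, hb⟩, rfl⟩
  obtain ⟨J, hJ, hr⟩ := Nat.sInf_mem hne
  obtain ⟨b, hle, hb⟩ := exists_reduction_le hℓ hJ.prop
  have hJb : J = Ideal.span (Set.range fun i => (b i : R)) :=
    le_antisymm (hJ.2 ⟨hle.trans hJ.prop.le, hb⟩ hle) hle
  refine ⟨b, ?_⟩
  rw [← hJb]
  have := Nat.sInf_mem (s := {s : ℕ | I ^ (s + 1) = J * I ^ s}) hJ.prop.2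
  change I ^ (reductionNumberWrt J I + 1) = J * I ^ reductionNumberWrt J I at this
  rw [← hr] at this
  exact this

theorem reductionNumber_le [IsNoetherianRing R] {ℓ : ℕ}
    (hℓ : analyticSpread I = ℓ) {b : Fin ℓ → I} {t : ℕ}
    (hb : I ^ (t + 1) = Ideal.span (Set.range fun i => (b i : R)) * I ^ t) :
    reductionNumber I ≤ t := by
  have hle : Ideal.span (Set.range fun i => (b i : R)) ≤ I :=
    Ideal.span_le.2 (by rintro _ ⟨i, rfl⟩; exact (b i).2)
  have h1 : reductionNumber I ≤ reductionNumberWrt (Ideal.span (Set.range fun i => (b i : R))) I :=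
    Nat.sInf_le ⟨_, isMinimalReductionOf_span hℓ ⟨hle, t, hb⟩, rfl⟩
  exact h1.trans (Nat.sInf_le hb)

end SpecialFiberRing

end Reductions

/-! ### Openness of the reduction equation. -/

section GeneralElements

/-- Some of the vectors at `c₀` form a basis. The determinant of the same selection in this basis is
a polynomial in `c` with value `1` at `c₀`, and wherever it is nonzero the selection still spans. -/
lemma Module.exists_polynomial_of_span_eq_top {k V κ T : Type*} [Field k] [AddCommGroup V]
    [Module k V] [FiniteDimensional k V] [Fintype κ] (L : T → (κ → k) →ₗ[k] V) {c₀ : κ → k}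
    (h₀ : Submodule.span k (Set.range fun t => L t c₀) = ⊤) :
    ∃ p : MvPolynomial κ k, p ≠ 0 ∧ ∀ c, MvPolynomial.eval c p ≠ 0 →
      Submodule.span k (Set.range fun t => L t c) = ⊤ := by
  classical
  obtain ⟨ι, σ, -, hspan, hli⟩ := exists_linearIndependent' k fun t => L t c₀
  let β : Module.Basis ι k V := Module.Basis.mk hli (by rw [hspan, h₀])
  have := FiniteDimensional.fintypeBasisIndex β
  let M : Matrix ι ι (MvPolynomial κ k) := Matrix.of fun i j =>
    ∑ m, MvPolynomial.C (β.repr (L (σ j) (Pi.single m 1)) i) * MvPolynomial.X m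
  have hM : ∀ c, MvPolynomial.eval c M.det = β.det fun j => L (σ j) c := by
    intro c
    rw [RingHom.map_det, Module.Basis.det_apply]
    congr 1
    ext i j
    have hc : c = ∑ m, c m • (Pi.single m 1 : κ → k) := by
      rw [pi_eq_sum_univ' c]
      simp [Pi.single_apply]
    rw [Module.Basis.toMatrix_apply]
    nth_rw 2 [hc]
    simp [M, mul_comm]
  refine ⟨M.det, fun h => ?_, fun c hc => ?_⟩
  · have h1 := hM c₀
    rw [h, map_zero] at h1
    have h2 : (fun j => L (σ j) c₀) = β := by ext j; simp [β]
    rw [h2, Module.Basis.det_self] at h1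
    exact zero_ne_one h1
  · rw [hM] at hc
    have h1 := ((β.is_basis_iff_det).2 (isUnit_iff_ne_zero.2 hc)).2
    rw [eq_top_iff, ← h1]
    refine Submodule.span_mono ?_
    rintro _ ⟨j, rfl⟩
    exact ⟨σ j, rfl⟩

lemma Submodule.exists_polynomial_of_le_span {k B ι κ T : Type*} [Field k] [AddCommGroup B]
    [Module k B] [Finite ι] [Fintype κ] {W : Submodule k B} (hW : W.FG) (e : κ → T → B)
    (he : ∀ j t, e j t ∈ W) {c₀ : ι × κ → k}
    (h₀ : W ≤ Submodule.span k (Set.range fun t : ι × T => ∑ j, c₀ (t.1, j) • e j t.2)) :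
    ∃ p : MvPolynomial (ι × κ) k, p ≠ 0 ∧ ∀ c, MvPolynomial.eval c p ≠ 0 →
      W ≤ Submodule.span k (Set.range fun t : ι × T => ∑ j, c (t.1, j) • e j t.2) := by
  have := Fintype.ofFinite ι
  have : FiniteDimensional k W := Module.Finite.iff_fg.2 hW
  let L : ι × T → (ι × κ → k) →ₗ[k] W := fun t =>
    ∑ j, (LinearMap.proj (t.1, j)).smulRight ⟨e j t.2, he j t.2⟩
  have hL : ∀ c, (Submodule.span k (Set.range fun t => L t c)).map W.subtype =
      Submodule.span k (Set.range fun t : ι × T => ∑ j, c (t.1, j) • e j t.2) := by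
    intro c
    rw [Submodule.map_span, ← Set.range_comp]
    congr 2
    ext t
    simp [L]
  obtain ⟨p, hp, hpc⟩ := Module.exists_polynomial_of_span_eq_top L (c₀ := c₀) (by
    refine eq_top_iff.2 fun z _ => ?_
    have := h₀ z.2
    rw [← hL] at this
    obtain ⟨z', hz', hzz⟩ := this
    rwa [← Subtype.ext hzz])
  refine ⟨p, hp, fun c hc => ?_⟩
  rw [← hL, hpc c hc, Submodule.map_top, Submodule.range_subtype]

variable {R : Type u} [CommRing R] [IsLocalRing R] {I : Ideal R}

namespace SpecialFiberRing

/-- Together with `mem_of_homogClass_mem_span_mul`, translates membership in `(a) I ^ s`, up to `𝔪 I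
^ (s + 1)`, into a linear span over the residue field. -/
lemma homogClass_mem_span_mul {ι : Type*} (a : ι → I) {s : ℕ} (v : ↥(I ^ (s + 1)))
    (hv : (v : R) ∈ Ideal.span (Set.range fun i => (a i : R)) * I ^ s) :
    homogClass I (s + 1) v ∈ Submodule.span (ResidueField R)
      (Set.range fun t : ι × ↥(I ^ s) => ofIdeal I (a t.1) * homogClass I s t.2) := by
  let N := Submodule.span (ResidueField R)
    (Set.range fun t : ι × ↥(I ^ s) => ofIdeal I (a t.1) * homogClass I s t.2)
  have hle : Ideal.span (Set.range fun i => (a i : R)) * I ^ s ≤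
      Submodule.map (Submodule.subtype (I ^ (s + 1)))
      ((N.restrictScalars R).comap (homogClass I (s + 1))) := by
    rw [Ideal.mul_le]
    intro x hx w hw
    induction hx using Submodule.span_induction generalizing w with
    | mem x hx =>
      obtain ⟨i, rfl⟩ := hx
      exact ⟨⟨a i * w, by rw [pow_succ']; exact Ideal.mul_mem_mul (a i).2 hw⟩,
        Submodule.subset_span ⟨(i, ⟨w, hw⟩), ofIdeal_mul_homogClass _ _⟩, rfl⟩
    | zero => rw [zero_mul]; exact Submodule.zero_mem _
    | add x y _ _ hx hy => rw [add_mul]; exact Submodule.add_mem _ (hx w hw) (hy w hw)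
    | smul c x _ hx =>
      rw [smul_eq_mul, mul_assoc]
      exact Submodule.smul_mem _ c (hx w hw)
  obtain ⟨v', hv', hvw⟩ := hle hv
  rw [show v = v' from Subtype.ext hvw.symm]
  exact hv'

lemma mem_of_homogClass_mem_span_mul {ι : Type*} [Finite ι] (a : ι → I) {s : ℕ}
    (v : ↥(I ^ (s + 1)))
    (hv : homogClass I (s + 1) v ∈ Submodule.span (ResidueField R)
      (Set.range fun t : ι × ↥(I ^ s) => ofIdeal I (a t.1) * homogClass I s t.2)) :
    (v : R) ∈ Ideal.span (Set.range fun i => (a i : R)) * I ^ s ⊔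
      maximalIdeal R * I ^ (s + 1) := by
  refine mem_of_homogClass_mem_span a v ?_
  have hle : Submodule.span (ResidueField R)
      (Set.range fun t : ι × ↥(I ^ s) => ofIdeal I (a t.1) * homogClass I s t.2) ≤
      (Ideal.span (Set.range fun i => ofIdeal I (a i))).restrictScalars (ResidueField R) := by
    refine Submodule.span_le.2 ?_
    rintro _ ⟨t, rfl⟩
    change ofIdeal I (a t.1) * homogClass I s t.2 ∈ Ideal.span (Set.range fun i => ofIdeal I (a i))
    have key : ∀ {B : Type u} [CommRing B] (J : Ideal B) (x y : B), x ∈ J → x * y ∈ J :=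
      fun J x y hx => J.mul_mem_right y hx
    have hi : ofIdeal I (a t.1) ∈ Ideal.span (Set.range fun i => ofIdeal I (a i)) :=
      Ideal.subset_span ⟨t.1, rfl⟩
    exact key (B := SpecialFiberRing I) _ _ _ hi
  exact hle hv

/-- If `I ^ (s + 1) = J I ^ s` for one ideal `J` generated by `ℓ` elements of `I`, then this holds
for the ideal generated by `ℓ` general elements of `I`. -/
theorem exists_polynomial_of_pow_eq [IsNoetherianRing R] {ℓ n s : ℕ} (f : Fin n → I)
    (hf : Ideal.span (Set.range fun j => (f j : R)) = I) (b : Fin ℓ → I)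
    (hb : I ^ (s + 1) = Ideal.span (Set.range fun i => (b i : R)) * I ^ s) :
    ∃ p : MvPolynomial (Fin ℓ × Fin n) (ResidueField R), p ≠ 0 ∧
      ∀ c : Fin ℓ × Fin n → R, MvPolynomial.eval (fun ij => residue R (c ij)) p ≠ 0 →
        I ^ (s + 1) = Ideal.span (Set.range fun i => ∑ j, c (i, j) * (f j : R)) * I ^ s := by
  have hL : ∀ (c : Fin ℓ × Fin n → R) (i : Fin ℓ) (w : ↥(I ^ s)),
      ∑ j, residue R (c (i, j)) • (ofIdeal I (f j) * homogClass I s w) =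
        ofIdeal I (∑ j, c (i, j) • f j) * homogClass I s w := by
    intro c i w
    rw [← ofIdealₗ_apply (∑ j, c (i, j) • f j), map_sum, Finset.sum_mul]
    refine Finset.sum_congr rfl fun j _ => ?_
    rw [ofIdealₗ_apply, ofIdeal_smul]
    exact (smul_mul_assoc _ _ _).symm
  have hbf : ∀ i, ∃ c : Fin n → R, ∑ j, c j • f j = b i := by
    intro i
    obtain ⟨c, hc⟩ := Ideal.mem_span_range_iff_exists_fun.1 (hf.symm ▸ (b i).2 :
      (b i : R) ∈ Ideal.span (Set.range fun j => (f j : R)))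
    exact ⟨c, Subtype.ext (by simpa using hc)⟩
  choose C hC using hbf
  obtain ⟨p, hp, hpc⟩ := Submodule.exists_polynomial_of_le_span (B := SpecialFiberRing I)
    (ι := Fin ℓ) (T := ↥(I ^ s)) (homogPart_fg (I := I) (s + 1))
    (fun j w => ofIdeal I (f j) * homogClass I s w)
    (fun j w => by rw [ofIdeal_mul_homogClass]; exact homogClass_mem_homogPart _ _)
    (c₀ := fun ij => residue R (C ij.1 ij.2)) (by
      rintro _ ⟨v, rfl⟩
      have := homogClass_mem_span_mul b v (hb ▸ v.2)
      simpa only [hL (fun ij => C ij.1 ij.2), hC] using this)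
  refine ⟨p, hp, fun c hc => le_antisymm (Ideal.le_of_le_sup_maximalIdeal_mul fun v hv => ?_) ?_⟩
  · have hmem := hpc _ hc (homogClass_mem_homogPart _ ⟨v, hv⟩)
    simp only [hL] at hmem
    simpa using mem_of_homogClass_mem_span_mul (fun i => ∑ j, c (i, j) • f j) ⟨v, hv⟩ hmem
  · rw [pow_succ']
    refine Ideal.mul_mono_left (Ideal.span_le.2 ?_)
    rintro _ ⟨i, rfl⟩
    exact Ideal.sum_mem _ fun j _ => I.mul_mem_left _ (f j).2

end SpecialFiberRing

end GeneralElements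

/-! ### Principal kernels: linear coordinate changes and Cohen-Macaulayness. -/

section Hypersurfaces

/-- The substitution of linear forms for the variables. -/
noncomputable def MvPolynomial.linearSubst {k σ : Type*} [CommRing k] [Fintype σ] (c : σ → σ → k) :
    MvPolynomial σ k →ₐ[k] MvPolynomial σ k := aeval fun j => ∑ i, C (c j i) * X i

lemma MvPolynomial.linearSubst_X {k σ : Type*} [CommRing k] [Fintype σ] (c : σ → σ → k) (j : σ) :
    linearSubst c (X j) = ∑ i, C (c j i) * X i := aeval_X _ _

lemma MvPolynomial.linearSubst_linearSubst_X {k σ : Type*} [CommRing k] [Fintype σ]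
    (c c' : σ → σ → k) (j : σ) :
    linearSubst c' (linearSubst c (X j)) = ∑ m, C (∑ i, c j i * c' i m) * X m := by
  rw [linearSubst_X, map_sum]
  have h : ∀ i, linearSubst c' (C (c j i) * X i) = ∑ m, C (c j i * c' i m) * X m := by
    intro i
    rw [map_mul, linearSubst_X, ← algebraMap_eq, AlgHom.commutes, algebraMap_eq, Finset.mul_sum]
    simp only [C_mul, mul_assoc]
  simp only [h]
  rw [Finset.sum_comm]
  simp only [← Finset.sum_mul, ← map_sum]

/-- A linear change of coordinates transports a principal kernel. -/
lemma MvPolynomial.exists_ker_generator_of_linear_change {k B σ : Type*} [Field k] [CommRing B]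
    [Algebra k B] [Fintype σ] (φ φ' : MvPolynomial σ k →ₐ[k] B)
    (hφ : ∀ j, ∃ c : σ → k, φ' (∑ i, C (c i) * X i) = φ (X j))
    (hφ' : ∀ j, ∃ c : σ → k, φ (∑ i, C (c i) * X i) = φ' (X j))
    (hli : ∀ c : σ → k, φ (∑ i, C (c i) * X i) = 0 → ∀ i, c i = 0)
    (hli' : ∀ c : σ → k, φ' (∑ i, C (c i) * X i) = 0 → ∀ i, c i = 0)
    {d : ℕ} {g : MvPolynomial σ k} (hg0 : g ≠ 0) (hg : g.IsHomogeneous d)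
    (hker : ∀ f, φ f = 0 ↔ f ∈ Ideal.span {g}) :
    ∃ g' : MvPolynomial σ k, g' ≠ 0 ∧ g'.IsHomogeneous d ∧
      ∀ f, φ' f = 0 ↔ f ∈ Ideal.span {g'} := by
  classical
  have subst : ∀ φ φ' : MvPolynomial σ k →ₐ[k] B,
      (∀ j, ∃ c : σ → k, φ (∑ i, C (c i) * X i) = φ' (X j)) →
        ∃ c, ∀ f, φ (linearSubst c f) = φ' f := by
    intro φ φ' h
    choose c hc using h
    refine ⟨c, fun f => ?_⟩
    rw [← AlgHom.comp_apply]
    congr 1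
    ext j
    rw [AlgHom.comp_apply, linearSubst_X, hc]
  -- The composite substitution does not change values under `φ`, and `φ` is injective on linear
  -- forms, so the composite fixes the variables.
  have inverse : ∀ (φ : MvPolynomial σ k →ₐ[k] B),
      (∀ c : σ → k, φ (∑ i, C (c i) * X i) = 0 → ∀ i, c i = 0) →
      ∀ c c', (∀ f, φ (linearSubst c' (linearSubst c f)) = φ f) →
        ∀ f, linearSubst c' (linearSubst c f) = f := by
    intro φ hli c c' h f
    rw [← AlgHom.comp_apply]
    conv_rhs => rw [← AlgHom.id_apply (R := k) f]
    congr 1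
    ext1 j
    have hX : (X j : MvPolynomial σ k) = ∑ m, C (if m = j then 1 else 0) * X m := by
      simp [apply_ite C]
    have h1 : linearSubst c' (linearSubst c (X j)) - X j =
        ∑ m, C (∑ i, c j i * c' i m - if m = j then 1 else 0) * X m := by
      conv_lhs => rw [linearSubst_linearSubst_X, hX, ← Finset.sum_sub_distrib]
      exact Finset.sum_congr rfl fun m _ => by rw [C_sub, sub_mul]
    have h2 := hli _ (by rw [← h1, map_sub, h, sub_self])
    rw [AlgHom.comp_apply, AlgHom.id_apply, ← sub_eq_zero, h1]
    exact Finset.sum_eq_zero fun m _ => by rw [h2, C_0, zero_mul]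
  obtain ⟨c, hc⟩ := subst φ φ' hφ'
  obtain ⟨c', hc'⟩ := subst φ' φ hφ
  have h12 := inverse φ hli c' c fun f => by rw [hc, hc']
  have h21 := inverse φ' hli' c c' fun f => by rw [hc', hc]
  refine ⟨linearSubst c' g, fun h => hg0 ?_, ?_, fun f => ⟨fun hf => ?_, fun hf => ?_⟩⟩
  · rw [← h12 g, h, map_zero]
  · have := hg.aeval (fun j => ∑ i, C (c' j i) * X i) fun j =>
      IsHomogeneous.sum _ _ 1 fun i _ => (isHomogeneous_X k i).C_mul _
    rwa [one_mul] at this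
  · rw [← hc, hker] at hf
    have := Ideal.mem_map_of_mem (linearSubst c') hf
    rwa [h21, Ideal.map_span, Set.image_singleton] at this
  · obtain ⟨q, rfl⟩ := Ideal.mem_span_singleton'.1 hf
    rw [map_mul, hc', (hker g).2 (Ideal.mem_span_singleton_self g), mul_zero]

lemma MvPolynomial.exists_quotient_algEquiv {k B σ : Type*} [Field k] [CommRing B] [Algebra k B]
    (φ : MvPolynomial σ k →ₐ[k] B) (hφ : Function.Surjective φ) {g : MvPolynomial σ k}
    (hker : ∀ f, φ f = 0 ↔ f ∈ Ideal.span {g}) :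
    ∃ e : (MvPolynomial σ k ⧸ Ideal.span {g}) ≃ₐ[k] B, ∀ f, e (Ideal.Quotient.mk _ f) = φ f := by
  have h : Ideal.span {g} = RingHom.ker φ := by
    ext f; rw [RingHom.mem_ker, hker]
  exact ⟨(Ideal.quotientEquivAlgOfEq k h).trans (Ideal.quotientKerAlgEquivOfSurjective hφ),
    fun f => rfl⟩

/-- Monicity in the first variable makes the quotient finite and free over the polynomial ring in
the other `ℓ` variables, so long regular sequences ascend to it. -/
lemma MvPolynomial.isCohenMacaulay_of_ker_eq_span
    {k B : Type u} [Field k] [CommRing B] [Algebra k B]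
    {ℓ : ℕ} (φ : MvPolynomial (Fin (ℓ + 1)) k →ₐ[k] B) (hφ : Function.Surjective φ)
    {g : MvPolynomial (Fin (ℓ + 1)) k} (hg : (finSuccEquiv k ℓ g).Monic)
    (hker : ∀ f, φ f = 0 ↔ f ∈ Ideal.span {g}) : IsCohenMacaulay B := by
  obtain ⟨e, -⟩ := exists_quotient_algEquiv φ hφ hker
  have := hg.free_adjoinRoot
  have := hg.finite_adjoinRoot
  have h1 : LocallyHasLongRegularSequence (AdjoinRoot (finSuccEquiv k ℓ g)) :=
    .of_flat_of_isIntegral (.mvPolynomial k (Fin ℓ))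
  have e' : (MvPolynomial (Fin (ℓ + 1)) k ⧸ Ideal.span {g}) ≃+* AdjoinRoot (finSuccEquiv k ℓ g) :=
    Ideal.quotientEquiv _ _ (finSuccEquiv k ℓ).toRingEquiv (by
      rw [Ideal.map_span, Set.image_singleton]; rfl)
  have : IsNoetherianRing B := isNoetherianRing_of_surjective _ _ φ.toRingHom hφ
  exact (h1.of_ringEquiv (e'.symm.trans e.toRingEquiv)).isCohenMacaulay

end Hypersurfaces

/-! ### Monicity in the distinguished variable. -/

section MonicForms

open MvPolynomial

variable {A : Type*} [CommRing A] {ℓ : ℕ}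

lemma map_monicForm {B : Type*} [CommRing B] (f : A →+* B)
    (v : Fin ℓ → MvPolynomial (Fin (ℓ + 1)) A) (d : ℕ) :
    (monicForm v d).map f = monicForm (fun i => (v i).map f) d := by
  simp [monicForm]

lemma monicForm_isHomogeneous {v : Fin ℓ → MvPolynomial (Fin (ℓ + 1)) A} {d : ℕ}
    (hv : ∀ i, (v i).IsHomogeneous d) : (monicForm v (d + 1)).IsHomogeneous (d + 1) :=
  (isHomogeneous_X_pow _ _).sub (IsHomogeneous.sum _ _ _ fun i _ =>
    add_comm 1 d ▸ (isHomogeneous_X _ _).mul (hv i))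

/-- Each `v i` has `X₀`-degree at most `d`, and the other variables are constants with respect to
`X₀`. -/
lemma finSuccEquiv_monicForm_monic {v : Fin ℓ → MvPolynomial (Fin (ℓ + 1)) A} {d : ℕ}
    (hv : ∀ i, (v i).IsHomogeneous d) : (finSuccEquiv A ℓ (monicForm v (d + 1))).Monic := by
  rw [monicForm, map_sub, map_pow, finSuccEquiv_X_zero, map_sum]
  refine Polynomial.monic_X_pow_sub ((Polynomial.degree_sum_le _ _).trans_lt ?_)
  rw [Finset.sup_lt_iff (WithBot.bot_lt_coe _)]
  intro i _
  rw [map_mul, finSuccEquiv_X_succ]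
  refine (Polynomial.degree_le_natDegree).trans_lt ?_
  have h1 := (degreeOf_le_totalDegree (v i) 0).trans (hv i).totalDegree_le
  rw [← natDegree_finSuccEquiv] at h1
  exact_mod_cast Nat.lt_succ_of_le ((Polynomial.natDegree_C_mul_le _ _).trans h1)

end MonicForms

/-! ### Assembling the presentation of the fiber ring. -/

section MainTheorem

variable {R : Type u} [CommRing R] [IsLocalRing R] {I : Ideal R}

/-- Elements of `𝔪 I ^ d` are values of forms of degree `d` with coefficients in `𝔪`. -/
lemma Ideal.exists_isHomogeneous_of_mem_maximalIdeal_mul {ι : Type*} (x : ι → R) {d : ℕ} {z : R}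
    (hz : z ∈ maximalIdeal R * Ideal.span (Set.range x) ^ d) :
    ∃ h : MvPolynomial ι R, h.IsHomogeneous d ∧ MvPolynomial.eval x h = z ∧
      h.map (residue R) = 0 := by
  refine Submodule.mul_induction_on hz (fun m hm w hw => ?_) ?_
  · obtain ⟨q, hq, rfl⟩ := (Ideal.mem_span_pow_iff_exists_isHomogeneous x w).1 hw
    refine ⟨MvPolynomial.C m * q, hq.C_mul m, by simp, ?_⟩
    rw [map_mul, MvPolynomial.map_C, (residue_eq_zero_iff m).2 hm, MvPolynomial.C_0, zero_mul]
  · rintro _ _ ⟨p, hp, rfl, hp0⟩ ⟨q, hq, rfl, hq0⟩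
    exact ⟨p + q, hp.add hq, map_add _ _ _, by rw [map_add, hp0, hq0, add_zero]⟩

namespace SpecialFiberRing

/-- The relations of the special fiber ring are generated by a single monic form. -/
lemma fiberEval_eq_zero_iff {ℓ s : ℕ} {a : Fin ℓ → R} {y : R} (H : ColonSequence I a y s)
    {v : Fin ℓ → MvPolynomial (Fin (ℓ + 1)) R} (hv : ∀ i, (v i).IsHomogeneous (s + 1))
    (hg : MvPolynomial.eval (Fin.cons y a : Fin (ℓ + 1) → R) (monicForm v (s + 2)) = 0)
    (x : Fin (ℓ + 1) → I) (hx : ∀ i, (x i : R) = (Fin.cons y a : Fin (ℓ + 1) → R) i)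
    (f : MvPolynomial (Fin (ℓ + 1)) (ResidueField R)) :
    fiberEval x f = 0 ↔ f ∈ Ideal.span {(monicForm v (s + 2)).map (residue R)} := by
  have hx' : (fun i => (x i : R)) = (Fin.cons y a : Fin (ℓ + 1) → R) := funext hx
  constructor
  · intro hf
    obtain ⟨h, rfl⟩ := MvPolynomial.map_surjective _ residue_surjective f
    rw [← MvPolynomial.sum_homogeneousComponent h, map_sum]
    refine Ideal.sum_mem _ fun d _ => ?_
    have h1 := eval_homogeneousComponent_mem x hf d
    rw [hx', ← H.span_eq] at h1
    -- Subtracting a form with the same value and coefficients in `𝔪` gives an exact relation with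
    -- the same reduction.
    obtain ⟨h', hh', he, h0⟩ := Ideal.exists_isHomogeneous_of_mem_maximalIdeal_mul _ h1
    have := H.map_residue_mem_span hv hg
      ((MvPolynomial.homogeneousComponent_isHomogeneous d h).sub hh')
      (by rw [map_sub, he, sub_self])
    rwa [map_sub, h0, sub_zero] at this
  · intro hf
    obtain ⟨q, rfl⟩ := Ideal.mem_span_singleton'.1 hf
    rw [map_mul, fiberEval_map_eq_zero x (monicForm_isHomogeneous hv)
      (by rw [hx', hg]; exact Submodule.zero_mem _)]
    exact mul_zero _

/-- By Nakayama, lifts of a basis of `I / 𝔪 I` generate `I`. -/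
lemma finrank_initialSpace_self [IsNoetherianRing R] :
    Module.finrank (ResidueField R) (initialSpace I I) = I.spanFinrank := by
  have := finiteDimensional_initialSpace (I := I) I
  refine le_antisymm ?_ ?_
  · obtain ⟨t, ht, htI⟩ := (IsNoetherian.noetherian I).exists_span_finset_card_eq_spanFinrank
    have htm : ∀ i : t, (i : R) ∈ I := fun i => by
      rw [← htI]; exact Submodule.subset_span i.2
    have hspan : Ideal.span (Set.range fun i : t => ((⟨i, htm i⟩ : I) : R)) = I := by
      simpa using htI
    have h1 := initialSpace_span (I := I) fun i : t => ⟨i, htm i⟩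
    rw [hspan] at h1
    rw [h1, ← ht]
    have := finrank_range_le_card (R := ResidueField R) fun i : t => ofIdeal I ⟨i, htm i⟩
    rwa [Fintype.card_coe] at this
  · obtain ⟨e, he⟩ := Submodule.exists_fin_span_eq (initialSpace I I)
    choose b hb hbe using fun i => exists_of_mem_initialSpace (I := I) (J := I)
      (z := e i) (he ▸ Submodule.subset_span ⟨i, rfl⟩)
    have hspan : Ideal.span (Set.range fun i => (b i : R)) = I := by
      refine le_antisymm (Ideal.span_le.2 (by rintro _ ⟨i, rfl⟩; exact hb i))
        (Ideal.le_of_le_sup_maximalIdeal_mul fun w hw => ?_)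
      refine mem_sup_of_ofIdeal_mem_initialSpace (w := ⟨w, hw⟩) ?_
      rw [initialSpace_span, funext hbe, he]
      exact Submodule.subset_span ⟨_, hw, rfl⟩
    have h2 := Submodule.spanFinrank_span_le_ncard_of_finite (R := R)
      (Set.finite_range fun i => (b i : R))
    change (Ideal.span (Set.range fun i => (b i : R))).spanFinrank ≤ _ at h2
    rw [hspan] at h2
    refine h2.trans ?_
    rw [← Nat.card_coe_set_eq]
    simpa using Finite.card_range_le fun i => (b i : R)

/-- Minimal generators have independent initial forms. -/
lemma linearIndependent_ofIdeal_of_span_eq [IsNoetherianRing R] {n : ℕ} (hn : I.spanFinrank = n)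
    {x : Fin n → I} (hx : Ideal.span (Set.range fun i => (x i : R)) = I) :
    LinearIndependent (ResidueField R) fun i => ofIdeal I (x i) := by
  rw [linearIndependent_iff_card_le_finrank_span, Fintype.card_fin, Set.finrank,
    ← initialSpace_span, hx, finrank_initialSpace_self, hn]

/-- An ideal whose initial space has codimension one is completed to `I` by one element. -/
lemma exists_sup_span_singleton_eq [IsNoetherianRing R] {ℓ : ℕ} (hgen : I.spanFinrank = ℓ + 1)
    {a : Fin ℓ → I} (ha : LinearIndependent (ResidueField R) fun i => ofIdeal I (a i)) :
    ∃ y : I, Ideal.span (Set.range fun i => ((Fin.cons y a : Fin (ℓ + 1) → I) i : R)) = I := by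
  have := finiteDimensional_initialSpace (I := I) I
  obtain ⟨y, hy⟩ : ∃ y : I, ofIdeal I y ∉
      Submodule.span (ResidueField R) (Set.range fun i => ofIdeal I (a i)) := by
    by_contra! hall
    have hle : initialSpace I I ≤
        Submodule.span (ResidueField R) (Set.range fun i => ofIdeal I (a i)) :=
      Submodule.span_le.2 (by rintro _ ⟨w, -, rfl⟩; exact hall w)
    have h1 := finrank_range_le_card (R := ResidueField R) fun i => ofIdeal I (a i)
    have h2 := FiniteDimensional.span_of_finite (ResidueField R)
      (Set.finite_range fun i => ofIdeal I (a i))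
    have h3 := Submodule.finrank_mono hle
    rw [finrank_initialSpace_self, hgen] at h3
    rw [Fintype.card_fin] at h1
    exact absurd (h3.trans h1) (by lia)
  refine ⟨y, ?_⟩
  have hli : LinearIndependent (ResidueField R)
      fun i => ofIdeal I ((Fin.cons y a : Fin (ℓ + 1) → I) i) := by
    have hcons : (fun i => ofIdeal I ((Fin.cons y a : Fin (ℓ + 1) → I) i)) =
        Fin.cons (ofIdeal I y) fun i => ofIdeal I (a i) := by
      funext i
      refine Fin.cases rfl (fun i => rfl) i
    rw [hcons]
    exact linearIndependent_finCons.2 ⟨ha, hy⟩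
  have hle : Ideal.span (Set.range fun i => ((Fin.cons y a : Fin (ℓ + 1) → I) i : R)) ≤ I :=
    Ideal.span_le.2 (by rintro _ ⟨i, rfl⟩; exact ((Fin.cons y a : Fin (ℓ + 1) → I) i).2)
  have heq := Submodule.eq_of_le_of_finrank_le (initialSpace_mono (I := I) hle) (by
    rw [finrank_initialSpace_self, hgen, initialSpace_span]
    rw [linearIndependent_iff_card_le_finrank_span, Fintype.card_fin] at hli
    exact hli)
  refine le_antisymm hle (Ideal.le_of_le_sup_maximalIdeal_mul fun w hw => ?_)
  refine mem_sup_of_ofIdeal_mem_initialSpace (w := ⟨w, hw⟩) ?_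
  rw [heq]
  exact Submodule.subset_span ⟨_, hw, rfl⟩

lemma fiberEval_sum_C_mul_X {ι : Type*} [Fintype ι] (x : ι → I) (c : ι → ResidueField R) :
    fiberEval x (∑ i, MvPolynomial.C (c i) * MvPolynomial.X i) = ∑ i, c i • ofIdeal I (x i) := by
  rw [map_sum]
  refine Finset.sum_congr rfl fun i _ => ?_
  rw [← MvPolynomial.smul_eq_C_mul, ← fiberEval_X]
  exact (fiberEval x).toLinearMap.map_smul _ _

lemma exists_fiberEval_sum_eq {ι : Type*} [Fintype ι] (x x' : ι → I)
    (hx' : Ideal.span (Set.range fun i => (x' i : R)) = I) (j : ι) :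
    ∃ c : ι → ResidueField R, fiberEval x' (∑ i, MvPolynomial.C (c i) * MvPolynomial.X i) =
      fiberEval x (MvPolynomial.X j) := by
  have h : ofIdeal I (x j) ∈ initialSpace I (Ideal.span (Set.range fun i => (x' i : R))) := by
    rw [hx']
    exact Submodule.subset_span ⟨_, (x j).2, rfl⟩
  rw [initialSpace_span] at h
  obtain ⟨c, hc⟩ := (Submodule.mem_span_range_iff_exists_fun _).1 h
  exact ⟨c, (fiberEval_sum_C_mul_X x' c).trans (hc.trans (fiberEval_X x j).symm)⟩

lemma isFiberHypersurface_of_ker {n d : ℕ} (x : Fin n → I)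
    (hx : Ideal.span (Set.range fun i => (x i : R)) = I)
    {g : MvPolynomial (Fin n) (ResidueField R)} (hg0 : g ≠ 0) (hg : g.IsHomogeneous d)
    (hker : ∀ f, fiberEval x f = 0 ↔ f ∈ Ideal.span {g}) : IsFiberHypersurface I x := by
  obtain ⟨e, he⟩ := MvPolynomial.exists_quotient_algEquiv (B := SpecialFiberRing I) (fiberEval x)
    (fiberEval_surjective x hx) hker
  exact ⟨d, g, hg0, hg, e, fun j => (he _).trans (fiberEval_X x j)⟩

/-- Being a hypersurface ring does not depend on the choice of minimal generators. -/
lemma isFiberHypersurface_of_ker_of_span_eq [IsNoetherianRing R] {n d : ℕ}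
    (hgen : I.spanFinrank = n) (x₀ : Fin n → I)
    (hx₀ : Ideal.span (Set.range fun i => (x₀ i : R)) = I)
    {g : MvPolynomial (Fin n) (ResidueField R)} (hg0 : g ≠ 0) (hg : g.IsHomogeneous d)
    (hker : ∀ f, fiberEval x₀ f = 0 ↔ f ∈ Ideal.span {g}) (x : Fin n → I)
    (hx : Ideal.span (Set.range fun i => (x i : R)) = I) : IsFiberHypersurface I x := by
  have hli : ∀ x : Fin n → I, Ideal.span (Set.range fun i => (x i : R)) = I →
      ∀ c : Fin n → ResidueField R,
        fiberEval x (∑ i, MvPolynomial.C (c i) * MvPolynomial.X i) = 0 → ∀ i, c i = 0 := by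
    intro x hx c hc
    rw [fiberEval_sum_C_mul_X] at hc
    exact Fintype.linearIndependent_iff.1 (linearIndependent_ofIdeal_of_span_eq hgen hx) c hc
  obtain ⟨g', hg0', hg', hker'⟩ := MvPolynomial.exists_ker_generator_of_linear_change
    (B := SpecialFiberRing I) (fiberEval x₀) (fiberEval x) (exists_fiberEval_sum_eq x₀ x hx)
    (exists_fiberEval_sum_eq x x₀ hx₀) (hli x₀ hx₀) (hli x hx) hg0 hg hker
  exact isFiberHypersurface_of_ker x hx hg0' hg' hker'

/-- The special fiber ring of an ideal with a colon sequence is a Cohen-Macaulay hypersurface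
ring. -/
theorem isCohenMacaulay_and_isFiberHypersurface [IsNoetherianRing R] {ℓ s : ℕ} {a : Fin ℓ → R}
    {y : R} (hgen : I.spanFinrank = ℓ + 1) (H : ColonSequence I a y s) :
    IsCohenMacaulay (SpecialFiberRing I) ∧
      ∀ x : Fin (ℓ + 1) → I, Ideal.span (Set.range fun i => (x i : R)) = I →
        IsFiberHypersurface I x := by
  obtain ⟨v, hv, hg⟩ := H.exists_monicForm
  obtain ⟨x₀, hx₀⟩ : ∃ x : Fin (ℓ + 1) → I, ∀ i,
      (x i : R) = (Fin.cons y a : Fin (ℓ + 1) → R) i :=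
    ⟨fun i => ⟨(Fin.cons y a : Fin (ℓ + 1) → R) i, H.span_eq.le (Ideal.subset_span ⟨i, rfl⟩)⟩,
      fun _ => rfl⟩
  have hspan₀ : Ideal.span (Set.range fun i => (x₀ i : R)) = I := by
    rw [funext hx₀]; exact H.span_eq
  have hker := fiberEval_eq_zero_iff H hv hg x₀ hx₀
  have hv' : ∀ i, ((v i).map (residue R)).IsHomogeneous (s + 1) := fun i => (hv i).map _
  rw [map_monicForm] at hker
  have hmonic := finSuccEquiv_monicForm_monic hv'
  exact ⟨MvPolynomial.isCohenMacaulay_of_ker_eq_span (B := SpecialFiberRing I) (fiberEval x₀)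
    (fiberEval_surjective x₀ hspan₀) hmonic hker,
    isFiberHypersurface_of_ker_of_span_eq hgen x₀ hspan₀
      (fun h => hmonic.ne_zero (by rw [h, map_zero])) (monicForm_isHomogeneous hv') hker⟩

/-- A reduction satisfying the colon conditions gives a colon sequence. -/
lemma exists_colonSequence [IsNoetherianRing R] {ℓ s : ℕ} (hℓ : analyticSpread I = ℓ)
    (hgen : I.spanFinrank = ℓ + 1) (hred : reductionNumber I = s + 1) {a : Fin ℓ → I}
    (ha : I ^ (s + 2) = Ideal.span (Set.range fun i => (a i : R)) * I ^ (s + 1))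
    (hcolon : ∀ i : Fin ℓ, ∀ x ∈ I ^ (s + 1),
      (a i : R) * x ∈ initialSpan (fun i => (a i : R)) i * I ^ s →
        x ∈ initialSpan (fun i => (a i : R)) i * I ^ s) :
    ∃ y, ColonSequence I (fun i => (a i : R)) y s := by
  have hle : Ideal.span (Set.range fun i => (a i : R)) ≤ I :=
    Ideal.span_le.2 (by rintro _ ⟨i, rfl⟩; exact (a i).2)
  obtain ⟨y, hy⟩ := exists_sup_span_singleton_eq hgen
    (linearIndependent_ofIdeal hℓ ⟨hle, s + 1, ha⟩)
  refine ⟨y, ?_, ha, fun hn => ?_, hcolon⟩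
  · convert hy using 3
    ext i
    refine Fin.cases ?_ (fun i => ?_) i <;> simp
  · have := reductionNumber_le hℓ (b := a) (t := s)
      (le_antisymm hn (by rw [pow_succ']; exact Ideal.mul_mono_left hle))
    lia

end SpecialFiberRing

end MainTheorem

open SpecialFiberRing in
theorem mainTheorem12 {R : Type u} [CommRing R] [IsLocalRing R] [IsNoetherianRing R]
    [Infinite (ResidueField R)] (I : Ideal R) (ℓ r : ℕ)
    (hspread : analyticSpread I = (ℓ : WithBot ℕ∞))
    (hgen : I.spanFinrank = ℓ + 1)
    (hred : reductionNumber I = r) :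
    HoldsForGeneral I ℓ (fun a =>
      (∀ i : Fin ℓ,
        (Ideal.span (a '' Set.Iio i) * I ^ (r - 1)).colon {a i} ⊓ I ^ r =
          Ideal.span (a '' Set.Iio i) * I ^ (r - 1)) →
      IsCohenMacaulay (SpecialFiberRing I) ∧
        ∀ x : Fin (ℓ + 1) → I, Submodule.span R (Set.range x) = ⊤ →
          IsFiberHypersurface I x) := by
  intro n f hf
  have hfI : ∀ j, f j ∈ I := fun j => hf ▸ Ideal.subset_span ⟨j, rfl⟩
  obtain ⟨b, hb⟩ := exists_span_pow_eq_reductionNumber hspread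
  rw [hred] at hb
  obtain ⟨p, hp, hpc⟩ := exists_polynomial_of_pow_eq (fun j => ⟨f j, hfI j⟩) hf b hb
  refine ⟨p, hp, fun c hc hcolon => ?_⟩
  -- If `r = 0`, where `r - 1` would be truncated, `I` itself would be generated by the `ℓ` elements
  -- `b`, contradicting `hgen`.
  obtain _ | s := r
  · exfalso
    rw [zero_add, pow_one, pow_zero, mul_one] at hb
    have h := Submodule.spanFinrank_span_le_ncard_of_finite (R := R)
      (Set.finite_range fun i => (b i : R))
    change (Ideal.span (Set.range fun i => (b i : R))).spanFinrank ≤ _ at h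
    rw [← hb, hgen, ← Nat.card_coe_set_eq] at h
    have h' := h.trans (Finite.card_range_le fun i => (b i : R))
    rw [Nat.card_fin] at h'
    lia
  let a : Fin ℓ → I := fun i => ⟨∑ j, c (i, j) * f j,
    Ideal.sum_mem _ fun j _ => I.mul_mem_left _ (hfI j)⟩
  obtain ⟨y, H⟩ := exists_colonSequence hspread hgen hred (a := a) (hpc c hc) fun i x hx hax => by
    have := hcolon i
    rw [Nat.add_sub_cancel] at this
    rw [initialSpan_eq_span_image_Iio, ← this]
    exact ⟨Submodule.mem_colon_singleton.2 (by rw [smul_eq_mul, mul_comm x]; exact hax), hx⟩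
  obtain ⟨hCM, hhyp⟩ := isCohenMacaulay_and_isFiberHypersurface hgen H
  refine ⟨hCM, fun x hx => hhyp x ?_⟩
  have := congrArg (Submodule.map I.subtype) hx
  rw [Submodule.map_span, ← Set.range_comp, Submodule.map_top, Submodule.range_subtype] at this
  exact this
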